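/- Let $\mathbb N=\{1,2,\dots\}$ and $\vec p=(p_k)_{k\in\mathbb N},\ \vec q=(q_k)_{k\in\mathbb N}\in(0,1)^{\mathbb N}$. The $\vec p$-excited random walk is the nearest-neighbour process $(X_n)_{n\ge 0}$ on $\mathbb Z$ with $X_0=0$ which, on its $k$-th departure from any site, steps to the right with probability $p_k$ and to the left with probability $1-p_k$, given the past. A real number $v(\vec p)$ is its speed if $X_n/n\to v(\vec p)$ almost surely. Write $\vec p\prec\vec q$ if there is a coupling of a sequence of independent variables $Y_j\sim\mathrm{Ber}(p_j)$ and a sequence of independent variables $Z_j\sim \mathrm{Ber}(q_j)$ such that $\sum_{j\le m}Y_j\le\sum_{j\le m}Z_j$ a.s. for every $m$, and $\sum_{j\le m}Y_j<\sum_{j\le m}Z_j$ with positive probability for some $m$. An arrow system is an element $\mathcal E$ of $\{-1,+1\}^{\mathbb Z\times\mathbb N}$; it defines a walk $E$ by $E_0=0$ and $E_{n+1}=E_n+\mathcal E(x,k)$ if $E_n=x$ and $\#\{m\le n:E_m=x\}=k$. Write $\mathcal L\preceq\mathcal R$ if $\sum_{j\le k}\mathcal L(x,j)\le\sum_{j\le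 k}\mathcal R(x,j)$ for all $x\in\mathbb Z$, $k\in\mathbb N$. For a path $X$, let $\mathcal D(X)$ be the set of regeneration levels, i.e. of those $x\in\mathbb Z$, $x\ge 0$, such that $X_n\ge x$ for all $n\ge\inf\{m\ge 0:X_m=x\}$, and let $T(X)=\inf\{n\ge 0:X_n\in\mathcal D(X)\setminus\{0\}\}$. **Proposition.** Suppose that the $\vec p$-excited random walk is a.s. transient to the right ($X_n\to+\infty$ a.s.) and that $\vec p\prec\vec q$. Then there is a probability space carrying random arrow systems $\mathcal L,\mathcal R$ with $\mathcal L\preceq\mathcal R$ a.s., such that the pairs $(\mathcal L(x,\cdot),\mathcal R(x,\cdot))$, $x\in\mathbb Z$, are i.i.d.; for each $x$ the arrows $\mathcal L(x,k)$, $k\in\mathbb N$ (resp. $\mathcal R(x,k)$, $k\in\mathbb N$) are independent and equal to $+1$ with probability $p_k$ (resp. $q_k$); the corresponding walks $L,R$ are a $\vec p$-excited and a $\vec q$-excited random walk; and the following hold. 1. $\mathcal D(L)\subseteq\mathcal D(R)$ a.s. 2. Let $T(\vec p)=T(L)$, $X_{T(\vec p)}=L_{T(L)}$, let $T_{\vec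 q}(\vec p)=\inf\{n\ge 0:R_n=L_{T(L)}\}$, and write $\{0\in\mathcal D(\vec p)\}$ for the event $\{0\in\mathcal D(L)\}$. Then $T(\vec p)$ and $T_{\vec q}(\vec p)$ are a.s. finite, $X_{T(\vec p)}\mathbf 1\{0\in\mathcal D(\vec p)\}$ is integrable, and the expectations $\mathbb E[T(\vec p)\mathbf 1\{0\in\mathcal D(\vec p)\}]$ and $\mathbb E[T_{\vec q}(\vec p)\mathbf 1\{0\in\mathcal D(\vec p)\}]$ lie in $(0,\infty]$. 3. The speeds $v(\vec p)$ and $v(\vec q)$ exist, and (with the convention $a/\infty=0$ for real $a$) $$v(\vec p)=\frac{\mathbb E[X_{T(\vec p)}\mathbf 1\{0\in\mathcal D(\vec p)\}]}{\mathbb E[T(\vec p)\mathbf 1\{0\in\mathcal D(\vec p)\}]},\qquad v(\vec q)=\frac{\mathbb E[X_{T(\vec p)}\mathbf 1\{0\in\mathcal D(\vec p)\}]}{\mathbb E[T_{\vec q}(\vec p)\mathbf 1\{0\in\mathcal D(\vec p)\}]}.$$ -/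

import Mathlib

open MeasureTheory ProbabilityTheory Filter Topology
open scoped ENNReal

namespace ExcitedRW

/-- A (non-random, elliptic) cookie environment on `ℤ`, i.e. an element of `(0,1)^ℕ`. The index
starts at `0`: `p k` is the probability of stepping to the right on the `(k+1)`-st departure from
a site. -/
abbrev CookieEnv : Type := ℕ → Set.Ioo (0 : ℝ) 1

/-- The `k`-th cookie, as an element of the closed unit interval. -/
def CookieEnv.prob (p : CookieEnv) (k : ℕ) : unitInterval :=
  ⟨(p k : ℝ), (p k).2.1.le, (p k).2.2.le⟩

/-- `p ≺ q`: there are a sequence `Y` of independent `Ber(p j)` variables and a sequence `Z` of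
independent `Ber(q j)` variables on a common probability space such that each partial sum of `Y` is
almost surely at most that of `Z`, and some partial sum of `Y` is strictly smaller with positive
probability. -/
def Precedes (p q : CookieEnv) : Prop :=
  ∃ (Ω : Type) (_ : MeasurableSpace Ω) (P : Measure Ω) (_ : IsProbabilityMeasure P)
    (Y Z : ℕ → Ω → ℕ),
    iIndepFun Y P ∧ (∀ j, HasLaw (Y j) (bernoulliMeasure 1 0 (p.prob j)) P) ∧
    iIndepFun Z P ∧ (∀ j, HasLaw (Z j) (bernoulliMeasure 1 0 (q.prob j)) P) ∧
    (∀ m : ℕ, P {ω | ∑ j ∈ Finset.range m, Y j ω ≤ ∑ j ∈ Finset.range m, Z j ω} = 1) ∧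
    (∃ m : ℕ, 0 < P {ω | ∑ j ∈ Finset.range m, Y j ω < ∑ j ∈ Finset.range m, Z j ω})

/-! ### The law of the excited random walk -/

/-- For a finite history `h = (h 0, …, h n)`, the number of visits to the current site `h n`
strictly before time `n`. -/
def earlierVisits (n : ℕ) (h : (i : Finset.Iic n) → ℤ) : ℕ :=
  (Finset.univ.filter fun i : Finset.Iic n =>
    (i : ℕ) < n ∧ h i = h ⟨n, Finset.mem_Iic.2 le_rfl⟩).card

/-- The transition kernel of the excited random walk in the environment `p`: on the `(k+1)`-st
departure from a site, step to the right with probability `p k` and to the left with probability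
`1 - p k`. -/
noncomputable def erwStep (p : CookieEnv) (n : ℕ) : Kernel ((i : Finset.Iic n) → ℤ) ℤ :=
  Kernel.ofFunOfCountable fun h =>
    bernoulliMeasure (h ⟨n, Finset.mem_Iic.2 le_rfl⟩ + 1) (h ⟨n, Finset.mem_Iic.2 le_rfl⟩ - 1)
      (p.prob (earlierVisits n h))

instance (p : CookieEnv) (n : ℕ) : IsMarkovKernel (erwStep p n) :=
  ⟨fun h => by
    change IsProbabilityMeasure (bernoulliMeasure _ _ _)
    infer_instance⟩

/-- The law, on the path space `ℕ → ℤ`, of the excited random walk in the environment `p` started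
at `0` (constructed by the Ionescu-Tulcea theorem). -/
noncomputable def erwLaw (p : CookieEnv) : Measure (ℕ → ℤ) :=
  Kernel.traj (X := fun _ => ℤ) (erwStep p) 0 (fun _ => 0)

/-- The excited random walk in the environment `p` is almost surely transient to the right. -/
def TransientRight (p : CookieEnv) : Prop :=
  ∀ᵐ X ∂(erwLaw p), Tendsto X atTop atTop

/-- The excited random walk in the environment `p` has the deterministic speed `v`, that is,
`X n / n → v` almost surely. -/
def IsSpeed (p : CookieEnv) (v : ℝ) : Prop :=
  ∀ᵐ X ∂(erwLaw p), Tendsto (fun n : ℕ => (X n : ℝ) / (n : ℝ)) atTop (𝓝 v)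

/-! ### Arrow systems -/

/-- An arrow system: an element of `{-1,+1}^(ℤ × ℕ)`. The arrow `E x k` is the step taken on the
`(k+1)`-st departure from `x`. -/
abbrev ArrowSystem : Type := ℤ → ℕ → ℤˣ

/-- One step of the walk along the arrows. The state consists of the current position and the
number of departures made so far from each site. -/
def ArrowSystem.next (E : ArrowSystem) (s : ℤ × (ℤ → ℕ)) : ℤ × (ℤ → ℕ) :=
  (s.1 + (E s.1 (s.2 s.1) : ℤ), Function.update s.2 s.1 (s.2 s.1 + 1))

/-- The nearest-neighbour walk, started at `0`, defined by an arrow system. -/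
def ArrowSystem.walk (E : ArrowSystem) (n : ℕ) : ℤ :=
  (E.next^[n] (0, fun _ => 0)).1

theorem ArrowSystem.walk_zero (E : ArrowSystem) : E.walk 0 = 0 := rfl

theorem ArrowSystem.departures_eq (E : ArrowSystem) (n : ℕ) (x : ℤ) :
    (E.next^[n] (0, fun _ => 0)).2 x = ((Finset.range n).filter fun m => E.walk m = x).card := by
  induction n with
  | zero => simp
  | succ n ih =>
    rw [Function.iterate_succ_apply', Finset.range_add_one, Finset.filter_insert]
    by_cases h : E.walk n = x
    · have h2 : (E.next^[n] (0, fun _ => 0)).1 = x := h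
      rw [if_pos h, Finset.card_insert_of_notMem (by simp), ← ih]
      simp [ArrowSystem.next, h2]
    · have h2 : x ≠ (E.next^[n] (0, fun _ => 0)).1 := fun h' => h h'.symm
      rw [if_neg h, ← ih]
      simp [ArrowSystem.next, Function.update_of_ne h2]

/-- The walk follows, on each departure from a site, the next unused arrow at that site. -/
theorem ArrowSystem.walk_succ (E : ArrowSystem) (n : ℕ) :
    E.walk (n + 1) = E.walk n +
      (E (E.walk n) ((Finset.range n).filter fun m => E.walk m = E.walk n).card : ℤ) := by
  rw [← ArrowSystem.departures_eq]
  change (E.next^[n + 1] (0, fun _ => 0)).1 = _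
  rw [Function.iterate_succ_apply']
  rfl

/-- The partial order `L ≼ R` on arrow systems. -/
def ArrowSystem.Le (L R : ArrowSystem) : Prop :=
  ∀ (x : ℤ) (k : ℕ), ∑ j ∈ Finset.range k, (L x j : ℤ) ≤ ∑ j ∈ Finset.range k, (R x j : ℤ)

/-- `(L, R)` is a pair of random arrow systems with `L ≼ R` such that the arrows of `L`
(resp. `R`) follow the environment `p` (resp. `q`), the pairs of stacks `(L x, R x)` are i.i.d. over
the sites `x`, and the walks of `L` and `R` are excited random walks in the environments
`p` and `q`. -/
structure IsArrowCoupling {Ω : Type*} [MeasurableSpace Ω] (P : Measure Ω) (p q : CookieEnv)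
    (L R : Ω → ArrowSystem) : Prop where
  measurable_left : Measurable L
  measurable_right : Measurable R
  indep_sites : iIndepFun (fun (x : ℤ) (ω : Ω) => (L ω x, R ω x)) P
  ident_sites : ∀ x : ℤ, IdentDistrib (fun ω => (L ω x, R ω x)) (fun ω => (L ω 0, R ω 0)) P P
  indep_left : ∀ x : ℤ, iIndepFun (fun (k : ℕ) (ω : Ω) => L ω x k) P
  indep_right : ∀ x : ℤ, iIndepFun (fun (k : ℕ) (ω : Ω) => R ω x k) P
  law_left : ∀ (x : ℤ) (k : ℕ), HasLaw (fun ω => L ω x k) (bernoulliMeasure 1 (-1) (p.prob k)) P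
  law_right : ∀ (x : ℤ) (k : ℕ), HasLaw (fun ω => R ω x k) (bernoulliMeasure 1 (-1) (q.prob k)) P
  le : ∀ᵐ ω ∂P, (L ω).Le (R ω)
  walk_left : HasLaw (fun ω => (L ω).walk) (erwLaw p) P
  walk_right : HasLaw (fun ω => (R ω).walk) (erwLaw q) P

/-! ### Regeneration levels -/

/-- The first hitting time of the set `S` by the path `X` (`⊤` if `S` is never hit). -/
noncomputable def hitTime (X : ℕ → ℤ) (S : Set ℤ) : ℕ∞ :=
  ⨅ (n : ℕ) (_ : X n ∈ S), (n : ℕ∞)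

/-- The set of (non-negative) regeneration levels of a path: the levels `x ≥ 0` such that the
path never goes to the left of `x` after it has reached `x`. -/
def regenLevels (X : ℕ → ℤ) : Set ℤ :=
  {x | 0 ≤ x ∧ ∀ n : ℕ, hitTime X {x} ≤ n → x ≤ X n}

/-- The hitting time of the first regeneration level to the right of the starting point. -/
noncomputable def regenTime (X : ℕ → ℤ) : ℕ∞ := hitTime X (regenLevels X \ {0})

/-- The position of the path at the time `regenTime X`, i.e. its first positive regeneration level
(meaningful when `regenTime X` is finite). -/
noncomputable def regenPos (X : ℕ → ℤ) : ℤ := X (regenTime X).toNat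

end ExcitedRW

/-! Comparison. Suppose `L.Le R`, and let the walk of `R` stay strictly to the left of the position
of the walk of `L` at time `t`. Conservation of flow through edges shows that the `R`-walk has then
crossed each edge, in each direction, at most as often as the `L`-walk has by time `t`
(`Le.crossings_le`). Counting departures, this cannot last `t + 1` steps, so `R` reaches every
non-negative level that `L` reaches. Applied to mirror images, the same fact says that `L` visits
`-1` if `R` does (`Le.stays`). A visited level `x ≥ 0` is a regeneration level exactly when the walk
of the system shifted by `x` never visits `-1` (`mem_regenLevels_iff`), whence the inclusion of
regeneration levels.

Speeds. Independence of the regeneration blocks is replaced by ergodic averages over sites. Each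
site `x` receives the `cost` of travelling from `x` to the next regeneration level of `L` if `x` is
itself one, and `0` otherwise. These costs telescope to hitting times (`hitTime_nextLevel`). They
are a stationary functional of the i.i.d. stacks, so Birkhoff's theorem makes the hitting time of
the first regeneration level beyond `N` asymptotic to `D * N`, with `D` the mean cost. Since
`L`-regeneration levels are regeneration levels of `R` too, this works for both walks with the same
levels. As `D` may be infinite, the ergodic theorem is needed for functions with values in `[0, ∞]`.

Normalisation. Transience gives regeneration levels a positive density (`measure_stays_ne_zero`), so
the first one beyond `N` is asymptotic to `N`. This yields the speed `1 / D`, and also, as in Kac's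
formula, that the mean gap on the event that `0` regenerates is `1` (`gapOn_average_eq_one`): the
common numerator equals `1`. -/

namespace ExcitedRW

/-! ### Edge crossings and comparison of ordered arrow systems -/

namespace ArrowSystem

/-- The number of departures from `x` before time `n`. -/
def dep (E : ArrowSystem) (n : ℕ) (x : ℤ) : ℕ := (E.next^[n] (0, fun _ => 0)).2 x

/-- The number of right arrows among the first `k` arrows at `x`. -/
def ups (E : ArrowSystem) (x : ℤ) (k : ℕ) : ℕ := Nat.count (fun j => E x j = 1) k

/-- The number of left arrows among the first `k` arrows at `x`. -/
def downs (E : ArrowSystem) (x : ℤ) (k : ℕ) : ℕ := Nat.count (fun j => E x j = -1) k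

variable (E : ArrowSystem)

@[simp] lemma dep_zero (x : ℤ) : E.dep 0 x = 0 := rfl

lemma dep_succ (n : ℕ) :
    E.dep (n + 1) = Function.update (E.dep n) (E.walk n) (E.dep n (E.walk n) + 1) := by
  unfold dep walk
  rw [Function.iterate_succ_apply']
  rfl

@[simp] lemma dep_succ_self (n : ℕ) : E.dep (n + 1) (E.walk n) = E.dep n (E.walk n) + 1 := by
  simp [dep_succ]

lemma dep_succ_of_ne {n : ℕ} {x : ℤ} (h : x ≠ E.walk n) : E.dep (n + 1) x = E.dep n x := by
  simp [dep_succ, h]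

lemma dep_le (n : ℕ) (x : ℤ) : E.dep n x ≤ n := by
  induction n with
  | zero => simp
  | succ n ih =>
    by_cases h : x = E.walk n
    · subst h; simpa using ih
    · rw [dep_succ_of_ne E h]; omega

lemma walk_succ_dep (n : ℕ) :
    E.walk (n + 1) = E.walk n + (E (E.walk n) (E.dep n (E.walk n)) : ℤ) := by
  unfold dep walk
  rw [Function.iterate_succ_apply']
  rfl

lemma walk_succ_eq_or (n : ℕ) : E.walk (n + 1) = E.walk n + 1 ∨ E.walk (n + 1) = E.walk n - 1 := by
  rw [walk_succ_dep]
  rcases Int.units_eq_one_or (E (E.walk n) (E.dep n (E.walk n))) with h | h <;> simp [h]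
  omega

lemma abs_walk_le (n : ℕ) : |E.walk n| ≤ n := by
  induction n with
  | zero => simp [walk_zero]
  | succ n ih =>
    rw [abs_le] at *
    push_cast
    rcases E.walk_succ_eq_or n with h | h <;> omega

lemma ups_add_downs (x : ℤ) (k : ℕ) : E.ups x k + E.downs x k = k := by
  induction k with
  | zero => simp [ups, downs]
  | succ k ih =>
    unfold ups downs at *
    rw [Nat.count_succ, Nat.count_succ]
    rcases Int.units_eq_one_or (E x k) with h | h <;> simp [h] <;> omega

lemma ups_mono (x : ℤ) : Monotone (E.ups x) := Nat.count_monotone _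

lemma downs_mono (x : ℤ) : Monotone (E.downs x) := Nat.count_monotone _

lemma sum_eq_ups (x : ℤ) (k : ℕ) :
    ∑ j ∈ Finset.range k, (E x j : ℤ) = 2 * E.ups x k - k := by
  induction k with
  | zero => simp [ups]
  | succ k ih =>
    rw [Finset.sum_range_succ, ih]
    unfold ups
    rw [Nat.count_succ]
    rcases Int.units_eq_one_or (E x k) with h | h <;> simp [h] <;> ring

lemma Le.ups_le {L R : ArrowSystem} (h : L.Le R) (x : ℤ) (k : ℕ) : L.ups x k ≤ R.ups x k := by
  have := h x k
  rw [sum_eq_ups, sum_eq_ups] at this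
  omega

lemma Le.downs_le {L R : ArrowSystem} (h : L.Le R) (x : ℤ) (k : ℕ) :
    R.downs x k ≤ L.downs x k := by
  have := h.ups_le x k
  have := L.ups_add_downs x k
  have := R.ups_add_downs x k
  omega

/-- Conservation of flow through the edge between `x` and `x + 1`. -/
lemma flow (n : ℕ) (x : ℤ) :
    E.ups x (E.dep n x) + (if x < 0 then 1 else 0) =
      E.downs (x + 1) (E.dep n (x + 1)) + (if x < E.walk n then 1 else 0) := by
  -- The net number of rightward crossings of the edge is `[x < walk n] - [x < 0]`; only departures
  -- from `x` or `x + 1` can change either side.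
  induction n with
  | zero => simp only [ups, downs, walk_zero, dep_zero, Nat.count_zero]; rfl
  | succ n ih =>
    have hstep := E.walk_succ_dep n
    by_cases h1 : x = E.walk n
    · have h2 : x + 1 ≠ E.walk n := by omega
      rw [dep_succ_of_ne E h2]
      subst h1
      rw [dep_succ_self, ups, Nat.count_succ]
      rw [if_neg (lt_irrefl _), ups] at ih
      rcases Int.units_eq_one_or (E (E.walk n) (E.dep n (E.walk n))) with h | h
      · rw [h] at hstep ⊢
        have : E.walk n < E.walk (n + 1) := by rw [hstep]; simp
        rw [if_pos this]; simp; omega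
      · rw [h] at hstep ⊢
        have : ¬ E.walk n < E.walk (n + 1) := by rw [hstep]; simp
        rw [if_neg this, if_neg (show ¬ (-1 : ℤˣ) = 1 by decide)]; omega
    · rw [dep_succ_of_ne E h1]
      by_cases h2 : x + 1 = E.walk n
      · obtain rfl : x = E.walk n - 1 := by omega
        rw [sub_add_cancel] at *
        rw [dep_succ_self, downs, Nat.count_succ]
        rw [if_pos (show E.walk n - 1 < E.walk n by omega), downs] at ih
        rcases Int.units_eq_one_or (E (E.walk n) (E.dep n (E.walk n))) with h | h
        · rw [h] at hstep ⊢
          have : E.walk n - 1 < E.walk (n + 1) := by rw [hstep]; simp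
          rw [if_pos this, if_neg (show ¬ (1 : ℤˣ) = -1 by decide)]; omega
        · rw [h] at hstep ⊢
          have : ¬ E.walk n - 1 < E.walk (n + 1) := by rw [hstep]; simp
          rw [if_neg this, if_pos rfl]; omega
      · rw [dep_succ_of_ne E h2, ih]
        have : x < E.walk (n + 1) ↔ x < E.walk n := by
          rcases E.walk_succ_eq_or n with h | h <;> omega
        simp [this]

variable {E} {L R : ArrowSystem}

/-- As long as the dominating walk stays to the left of the position of the dominated walk at
time `t`, it has crossed each edge, in each direction, at most as often. -/
lemma Le.crossings_le (h : L.Le R) {n t : ℕ} (hn : ∀ m < n, R.walk m < L.walk t) (y : ℤ) :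
    R.ups y (R.dep n y) ≤ L.ups y (L.dep t y) ∧ R.downs y (R.dep n y) ≤ L.downs y (L.dep t y) := by
  induction n generalizing y with
  | zero => simp [ups, downs]
  | succ n ih =>
    have ih' := ih fun m hm => hn m (by omega)
    by_cases hy : y = R.walk n
    swap
    · rw [dep_succ_of_ne R hy]; exact ih' y
    have hlt : y < L.walk t := hy ▸ hn n (by omega)
    have hstep := R.walk_succ_dep n
    have hL := L.flow t y
    have hdep : R.dep (n + 1) y = R.dep n y + 1 := by subst hy; simp
    have hR1 := R.flow (n + 1) y
    have hR := R.flow n y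
    rw [dep_succ_of_ne R (x := y + 1) (by omega), hdep] at hR1
    rw [← hy] at hstep hR
    rw [if_pos hlt] at hL
    rw [if_neg (lt_irrefl _)] at hR
    have hsum := R.ups_add_downs y (R.dep n y + 1)
    have hsum0 := R.ups_add_downs y (R.dep n y)
    have hsumL := L.ups_add_downs y (L.dep t y)
    have h1 := (ih' y)
    have h2 := (ih' (y + 1)).2
    have hm := R.ups_mono y (Nat.le_succ (R.dep n y))
    have hm' := R.downs_mono y (Nat.le_succ (R.dep n y))
    simp only [Nat.succ_eq_add_one] at hm hm'
    have hle1 : (if y < R.walk (n + 1) then 1 else 0) ≤ 1 := by split_ifs <;> simp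
    rw [hdep]
    -- Right crossings: on the edge from `y` to `y + 1`, `L` has one surplus right crossing because
    -- `y < L.walk t`, and `R` has at most one (up to the common term `[y < 0]`), while the left
    -- crossings compare by induction.
    refine ⟨by omega, ?_⟩
    by_contra! hcon
    -- Before its step `R` has no surplus at this edge, so it is at least one right crossing behind
    -- `L`. That absorbs the one extra left crossing, and the order of the stacks can be used at the
    -- index `R.dep n y + 1`.
    have hk : R.dep n y + 1 ≤ L.dep t y := by omega
    have := L.downs_mono y hk
    have := h.downs_le y (R.dep n y + 1)
    omega

lemma Le.dep_le_dep (h : L.Le R) {n t : ℕ} (hn : ∀ m < n, R.walk m < L.walk t) (y : ℤ) :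
    R.dep n y ≤ L.dep t y := by
  have := h.crossings_le hn y
  have := R.ups_add_downs y (R.dep n y)
  have := L.ups_add_downs y (L.dep t y)
  omega

lemma sum_dep {n K : ℕ} (h : n ≤ K) : ∑ y ∈ Finset.Icc (-K : ℤ) K, E.dep n y = n := by
  induction n with
  | zero => simp
  | succ n ih =>
    have hmem : E.walk n ∈ Finset.Icc (-K : ℤ) K := by
      have := abs_le.1 (E.abs_walk_le n)
      rw [Finset.mem_Icc]; omega
    rw [dep_succ, Finset.sum_update_of_mem hmem]
    have := ih (by omega)
    rw [← Finset.add_sum_erase _ _ hmem, ← Finset.sdiff_singleton_eq_erase] at this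
    omega

/-- Otherwise the comparison of departures holds at every site for `R` at time `t + 1` against `L`
at time `t`, and summing over a window containing both ranges gives `t + 1 ≤ t`. -/
lemma Le.exists_walk_ge (h : L.Le R) (t : ℕ) : ∃ m ≤ t, L.walk t ≤ R.walk m := by
  by_contra! hcon
  have h1 : ∀ y, R.dep (t + 1) y ≤ L.dep t y := h.dep_le_dep fun m hm => hcon m (by omega)
  have h2 := Finset.sum_le_sum fun y (_ : y ∈ Finset.Icc (-(t + 1 : ℕ) : ℤ) (t + 1 : ℕ)) => h1 y
  rw [sum_dep (by omega), sum_dep (by omega)] at h2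
  omega

lemma exists_walk_eq {n : ℕ} {b : ℤ} (h0 : 0 ≤ b) (hb : b ≤ E.walk n) : ∃ m ≤ n, E.walk m = b := by
  induction n with
  | zero => exact ⟨0, le_rfl, le_antisymm (by simpa [walk_zero] using h0) hb⟩
  | succ n ih =>
    by_cases h : b ≤ E.walk n
    · obtain ⟨m, hm, rfl⟩ := ih h
      exact ⟨m, by omega, rfl⟩
    · refine ⟨n + 1, le_rfl, ?_⟩
      rcases E.walk_succ_eq_or n with h' | h' <;> omega

lemma Le.exists_walk_eq (h : L.Le R) {t : ℕ} {b : ℤ} (h0 : 0 ≤ b) (hb : L.walk t = b) :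
    ∃ m, R.walk m = b := by
  obtain ⟨m, -, hm⟩ := h.exists_walk_ge t
  obtain ⟨k, -, hk⟩ := ArrowSystem.exists_walk_eq h0 (hb ▸ hm)
  exact ⟨k, hk⟩

/-- The mirror image of an arrow system. -/
def mirror (E : ArrowSystem) : ArrowSystem := fun x k => -E (-x) k

lemma mirror_walk_dep (n : ℕ) : E.mirror.walk n = -E.walk n ∧ ∀ x, E.mirror.dep n x = E.dep n (-x) := by
  induction n with
  | zero => simp [walk_zero]
  | succ n ih =>
    constructor
    · rw [walk_succ_dep, walk_succ_dep, ih.1, ih.2]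
      simp [mirror]; ring
    · intro x
      by_cases hx : x = E.mirror.walk n
      · have : -x = E.walk n := by rw [hx, ih.1, neg_neg]
        rw [this]
        subst hx
        rw [dep_succ_self, dep_succ_self, ih.2, this]
      · rw [dep_succ_of_ne _ hx, dep_succ_of_ne, ih.2]
        rw [ih.1] at hx
        omega

lemma Le.mirror (h : L.Le R) : R.mirror.Le L.mirror := by
  intro x k
  simpa [ArrowSystem.mirror] using h (-x) k

/-- The walk never goes to the left of its starting point. -/
def Stays (E : ArrowSystem) : Prop := ∀ n, E.walk n ≠ -1

lemma Stays.nonneg (h : E.Stays) (n : ℕ) : 0 ≤ E.walk n := by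
  induction n with
  | zero => simp [walk_zero]
  | succ n ih =>
    have := h (n + 1)
    rcases E.walk_succ_eq_or n with h' | h' <;> omega

/-- Reflection reverses the order, so a visit of `R` to `-1` is a visit of the dominated mirror walk
to `1`, which the mirror walk of `L` must match. -/
lemma Le.stays (h : L.Le R) (hL : L.Stays) : R.Stays := by
  intro n hn
  obtain ⟨m, hm⟩ := h.mirror.exists_walk_eq (t := n) (b := 1) (by simp)
    (by rw [(mirror_walk_dep n).1, hn]; rfl)
  rw [(mirror_walk_dep m).1] at hm
  exact hL m (by omega)

end ArrowSystem

end ExcitedRW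

/-! ### Hitting times, restarts and regeneration levels -/

namespace ExcitedRW

section HitTime

variable {X : ℕ → ℤ} {S : Set ℤ}

lemma hitTime_le {n : ℕ} (h : X n ∈ S) : hitTime X S ≤ n := iInf₂_le n h

lemma hitTime_eq {n : ℕ} (h : X n ∈ S) (h' : ∀ m < n, X m ∉ S) : hitTime X S = n := by
  refine le_antisymm (hitTime_le h) (le_iInf₂ fun m hm => ?_)
  by_contra! hlt
  exact h' m (by exact_mod_cast hlt) hm

lemma exists_hitTime_eq (h : ∃ n, X n ∈ S) :
    ∃ n : ℕ, hitTime X S = n ∧ X n ∈ S ∧ ∀ m < n, X m ∉ S := by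
  classical
  exact ⟨Nat.find h, hitTime_eq (Nat.find_spec h) fun m hm => Nat.find_min h hm, Nat.find_spec h,
    fun m hm => Nat.find_min h hm⟩

lemma hitTime_ne_top (h : ∃ n, X n ∈ S) : hitTime X S ≠ ⊤ := by
  obtain ⟨n, hn, -⟩ := exists_hitTime_eq h
  simp [hn]

end HitTime

namespace ArrowSystem

/-- The arrow system seen from the site `x`. -/
def shift (E : ArrowSystem) (x : ℤ) : ArrowSystem := fun y => E (x + y)

lemma shift_shift (E : ArrowSystem) (x y : ℤ) : (E.shift x).shift y = E.shift (x + y) := by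
  funext z
  simp [shift, add_assoc]

@[simp] lemma shift_zero (E : ArrowSystem) : E.shift 0 = E := by
  funext z
  simp [shift]

lemma Le.shift {L R : ArrowSystem} (h : L.Le R) (x : ℤ) : (L.shift x).Le (R.shift x) :=
  fun y k => h (x + y) k

variable {E E' : ArrowSystem} {x : ℤ}

lemma nonneg_of_ne_neg_one {m : ℕ} (h : ∀ i < m, E.walk i ≠ -1) : ∀ i < m, 0 ≤ E.walk i := by
  intro i hi
  induction i with
  | zero => simp [walk_zero]
  | succ i ih =>
    have := ih (by omega)
    have := h _ hi
    rcases E.walk_succ_eq_or i with h' | h' <;> omega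

lemma lt_of_first_hit (hx : 0 ≤ x) {n : ℕ} (h : ∀ m < n, E.walk m ≠ x) : ∀ m < n, E.walk m < x := by
  intro m hm
  by_contra! hge
  obtain ⟨k, hk, hk'⟩ := exists_walk_eq hx hge
  exact h k (by omega) hk'

lemma dep_eq_zero {n : ℕ} {y : ℤ} (h : ∀ m < n, E.walk m ≠ y) : E.dep n y = 0 := by
  induction n with
  | zero => rfl
  | succ n ih =>
    rw [dep_succ_of_ne _ (h n (by omega)).symm]
    exact ih fun m hm => h m (by omega)

/-- After reaching `x` for the first time from the left, and until it goes to the left of `x`, the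
walk follows the arrows of the shifted system. -/
lemma walk_restart (hE : ∀ y, 0 ≤ y → E' y = E (x + y)) {h : ℕ} (hx : E.walk h = x)
    (hlt : ∀ i < h, E.walk i < x) {m : ℕ} (hm : ∀ i < m, E'.walk i ≠ -1) :
    E.walk (h + m) = x + E'.walk m ∧ ∀ y, 0 ≤ y → E.dep (h + m) (x + y) = E'.dep m y := by
  induction m with
  | zero =>
    refine ⟨by simp [hx, walk_zero], fun y hy => ?_⟩
    rw [add_zero, dep_eq_zero fun i hi => ?_]
    · rfl
    · have := hlt i hi
      omega
  | succ m ih =>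
    obtain ⟨h1, h2⟩ := ih fun i hi => hm i (by omega)
    have h0 := nonneg_of_ne_neg_one hm m (by omega)
    constructor
    · rw [← add_assoc, walk_succ_dep, walk_succ_dep, h1, h2 _ h0, hE _ h0, add_assoc]
    · intro y hy
      by_cases hy' : y = E'.walk m
      · have h3 : x + y = E.walk (h + m) := by omega
        rw [← add_assoc, h3, dep_succ_self, ← h3, h2 _ hy, hy', dep_succ_self]
      · rw [← add_assoc, dep_succ_of_ne _ (by omega), dep_succ_of_ne _ hy', h2 _ hy]

lemma Stays.walk_eq_of_agree (hE : ∀ y, 0 ≤ y → E' y = E y) (h : E'.Stays) :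
    E.walk = E'.walk := by
  funext m
  have := (walk_restart (x := 0) (h := 0) (m := m) (E := E) (E' := E') (by simpa using hE)
    (walk_zero E) (by simp) fun i _ => h i).1
  simpa using this

lemma Stays.of_agree (hE : ∀ y, 0 ≤ y → E' y = E y) (h : E'.Stays) : E.Stays := by
  intro n
  rw [h.walk_eq_of_agree hE]
  exact h n

lemma stays_congr (hE : ∀ y, 0 ≤ y → E' y = E y) : E'.Stays ↔ E.Stays :=
  ⟨Stays.of_agree hE, Stays.of_agree fun y hy => (hE y hy).symm⟩

lemma Stays.walk_add (h : (E.shift x).Stays) {n : ℕ} (hx : E.walk n = x)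
    (hlt : ∀ i < n, E.walk i < x) (m : ℕ) : E.walk (n + m) = x + (E.shift x).walk m :=
  (walk_restart (fun _ _ => rfl) hx hlt fun i _ => h i).1

/-- At the first visit to `x` no arrow at a site `≥ x` has been used, so from then on the walk
copies that of the shifted system until the latter first steps to `-1`. -/
lemma mem_regenLevels_iff (hx : 0 ≤ x) (hit : ∃ n, E.walk n = x) :
    x ∈ regenLevels E.walk ↔ (E.shift x).Stays := by
  obtain ⟨n, hn, hnx, hlt⟩ := exists_hitTime_eq (X := E.walk) (S := {x}) hit
  simp only [Set.mem_singleton_iff] at hnx hlt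
  have hlt := lt_of_first_hit hx hlt
  constructor
  · rintro ⟨-, h⟩
    by_contra hcon
    unfold Stays at hcon
    push Not at hcon
    classical
    have hm := (walk_restart (E := E) (E' := E.shift x) (fun _ _ => rfl) hnx hlt
      (m := Nat.find hcon) fun i hi => Nat.find_min hcon hi).1
    rw [Nat.find_spec hcon] at hm
    have := h (n + Nat.find hcon) (by rw [hn]; exact_mod_cast Nat.le_add_right _ _)
    omega
  · intro h
    refine ⟨hx, fun m hm => ?_⟩
    rw [hn] at hm
    obtain ⟨k, rfl⟩ := Nat.exists_eq_add_of_le (by exact_mod_cast hm : n ≤ m)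
    rw [h.walk_add hnx hlt]
    have := h.nonneg k
    omega

lemma Stays.hitTime_add (h : (E.shift x).Stays) (hx : 0 ≤ x) (hit : ∃ n, E.walk n = x) {y : ℤ}
    (hy : 0 ≤ y) (hit' : ∃ n, (E.shift x).walk n = y) :
    hitTime E.walk {x + y} = hitTime E.walk {x} + hitTime (E.shift x).walk {y} := by
  obtain ⟨n, hn, hnx, hlt⟩ := exists_hitTime_eq (X := E.walk) (S := {x}) hit
  obtain ⟨m, hm, hmy, hlt'⟩ := exists_hitTime_eq (X := (E.shift x).walk) (S := {y}) hit'
  simp only [Set.mem_singleton_iff] at hnx hlt hmy hlt'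
  have hlt := lt_of_first_hit hx hlt
  rw [hn, hm, ← Nat.cast_add]
  refine hitTime_eq ?_ fun i hi => ?_
  · rw [h.walk_add hnx hlt, hmy]; rfl
  · rw [Set.mem_singleton_iff]
    by_cases hin : i < n
    · have := hlt i hin
      omega
    · obtain ⟨k, rfl⟩ := Nat.exists_eq_add_of_le (not_lt.1 hin)
      rw [h.walk_add hnx hlt]
      have := hlt' k (by omega)
      omega

lemma Stays.exists_walk_shift_eq (h : (E.shift x).Stays) (hx : 0 ≤ x) (hit : ∃ n, E.walk n = x)
    {y : ℤ} (hy : 0 ≤ y) (hit' : ∃ n, E.walk n = x + y) : ∃ n, (E.shift x).walk n = y := by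
  obtain ⟨n, hn, hnx, hlt⟩ := exists_hitTime_eq (X := E.walk) (S := {x}) hit
  simp only [Set.mem_singleton_iff] at hnx hlt
  have hlt := lt_of_first_hit hx hlt
  obtain ⟨k, hk⟩ := hit'
  have hnk : n ≤ k := by
    by_contra! hcon
    have := hlt k hcon
    omega
  obtain ⟨m, rfl⟩ := Nat.exists_eq_add_of_le hnk
  rw [h.walk_add hnx hlt] at hk
  exact ⟨m, by omega⟩

/-! ### Decomposition of hitting times along regeneration levels -/

/-- The first positive level from which the walk never backtracks. -/
noncomputable def gap (L : ArrowSystem) : ℕ := sInf {y : ℕ | 0 < y ∧ (L.shift y).Stays}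

/-- The first level, at least `N`, from which the walk never backtracks. -/
noncomputable def nextLevel (L : ArrowSystem) (N : ℕ) : ℕ :=
  sInf {y : ℕ | N ≤ y ∧ (L.shift y).Stays}

open Classical in
/-- The time that the walk of `E` needs to reach the first positive regeneration level of the walk
of `L`, on the event that `0` is a regeneration level of the latter. -/
noncomputable def cost (L E : ArrowSystem) : ℝ≥0∞ :=
  if L.Stays then (hitTime E.walk {(L.gap : ℤ)} : ℝ≥0∞) else 0

open Classical in
/-- The first positive regeneration level, on the event that `0` is a regeneration level. -/
noncomputable def gapOn (L : ArrowSystem) : ℝ≥0∞ := if L.Stays then (L.gap : ℝ≥0∞) else 0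

variable {L : ArrowSystem}

lemma nextLevel_spec (hinf : ∀ N : ℕ, ∃ y : ℕ, N ≤ y ∧ (L.shift y).Stays) (N : ℕ) :
    N ≤ L.nextLevel N ∧ (L.shift (L.nextLevel N)).Stays :=
  Nat.sInf_mem (s := {y : ℕ | N ≤ y ∧ (L.shift y).Stays}) (hinf N)

lemma nextLevel_le {N y : ℕ} (h : N ≤ y) (hy : (L.shift y).Stays) : L.nextLevel N ≤ y :=
  Nat.sInf_le (s := {y : ℕ | N ≤ y ∧ (L.shift y).Stays}) ⟨h, hy⟩

lemma gap_spec (hinf : ∀ N : ℕ, ∃ y : ℕ, N ≤ y ∧ (L.shift y).Stays) :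
    0 < L.gap ∧ (L.shift L.gap).Stays :=
  Nat.sInf_mem (s := {y : ℕ | 0 < y ∧ (L.shift y).Stays}) (hinf 1)

lemma nextLevel_succ_of_stays {N : ℕ} (h : (L.shift N).Stays)
    (hinf : ∀ N : ℕ, ∃ y : ℕ, N ≤ y ∧ (L.shift y).Stays) :
    L.nextLevel N = N ∧ L.nextLevel (N + 1) = N + (L.shift N).gap := by
  refine ⟨le_antisymm (nextLevel_le le_rfl h) (nextLevel_spec hinf N).1, ?_⟩
  have hs := nextLevel_spec hinf (N + 1)
  apply le_antisymm
  · have := gap_spec (L := L.shift N) (by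
      intro M
      obtain ⟨y, hy, hy'⟩ := hinf (N + M)
      refine ⟨y - N, by omega, ?_⟩
      rwa [shift_shift, Nat.cast_sub (by omega), add_sub_cancel])
    refine nextLevel_le (by omega) ?_
    rw [shift_shift] at this
    exact_mod_cast this.2
  · have : (L.shift N).gap ≤ L.nextLevel (N + 1) - N := by
      refine Nat.sInf_le ⟨by omega, ?_⟩
      rw [shift_shift, Nat.cast_sub (by omega), add_sub_cancel]
      exact hs.2
    omega

lemma nextLevel_succ_of_not_stays {N : ℕ} (h : ¬ (L.shift N).Stays) :
    L.nextLevel (N + 1) = L.nextLevel N := by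
  unfold nextLevel
  congr 1
  ext y
  simp only [Set.mem_ofPred_eq, and_congr_left_iff]
  intro hy
  have : y ≠ N := fun h' => h (h' ▸ hy)
  omega

/-- Telescoping: `nextLevel` moves between `N` and `N + 1` only if `N` regenerates for `L`. In that
case `E` restarts afresh at `N`, and the cost at `N` is the time to the next level. -/
lemma hitTime_nextLevel (hinf : ∀ N : ℕ, ∃ y : ℕ, N ≤ y ∧ (L.shift y).Stays)
    (hit : ∀ x : ℕ, ∃ n, E.walk n = x) (hE : ∀ x : ℕ, (L.shift x).Stays → (E.shift x).Stays)
    (N : ℕ) :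
    (hitTime E.walk {(L.nextLevel N : ℤ)} : ℝ≥0∞) = (hitTime E.walk {(L.nextLevel 0 : ℤ)} : ℝ≥0∞) +
      ∑ x ∈ Finset.range N, (L.shift x).cost (E.shift x) := by
  induction N with
  | zero => simp
  | succ N ih =>
    rw [Finset.sum_range_succ, ← add_assoc, ← ih]
    by_cases h : (L.shift N).Stays
    · obtain ⟨h1, h2⟩ := nextLevel_succ_of_stays h hinf
      rw [h1, h2, cost, if_pos h, Nat.cast_add, (hE N h).hitTime_add (by omega) (hit N) (by omega),
        ENat.toENNReal_add]
      exact (hE N h).exists_walk_shift_eq (by omega) (hit N) (by omega)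
        (by exact_mod_cast hit (N + (L.shift N).gap))
    · rw [nextLevel_succ_of_not_stays h, cost, if_neg h, add_zero]

lemma nextLevel_eq_sum (hinf : ∀ N : ℕ, ∃ y : ℕ, N ≤ y ∧ (L.shift y).Stays) (N : ℕ) :
    (L.nextLevel N : ℝ≥0∞) = L.nextLevel 0 + ∑ x ∈ Finset.range N, (L.shift x).gapOn := by
  induction N with
  | zero => simp
  | succ N ih =>
    rw [Finset.sum_range_succ, ← add_assoc, ← ih]
    by_cases h : (L.shift N).Stays
    · obtain ⟨h1, h2⟩ := nextLevel_succ_of_stays h hinf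
      rw [h1, h2, gapOn, if_pos h, Nat.cast_add]
    · rw [nextLevel_succ_of_not_stays h, gapOn, if_neg h, add_zero]

/-- A nearest-neighbour walk from `0` meets the non-negative levels in increasing order, so the
first positive regeneration level hit is the smallest one. -/
lemma regenTime_eq (hinf : ∀ N : ℕ, ∃ y : ℕ, N ≤ y ∧ (L.shift y).Stays)
    (hit : ∀ x : ℕ, ∃ n, L.walk n = x) :
    regenTime L.walk = hitTime L.walk {(L.gap : ℤ)} ∧ regenPos L.walk = L.gap := by
  obtain ⟨n, hn, hnx, hlt⟩ := exists_hitTime_eq (X := L.walk) (S := {(L.gap : ℤ)}) (hit L.gap)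
  simp only [Set.mem_singleton_iff] at hnx hlt
  have hlt := lt_of_first_hit (by omega) hlt
  have hg := gap_spec hinf
  have key : regenTime L.walk = n := by
    refine hitTime_eq ?_ fun m hm hmem => ?_
    · rw [hnx]
      refine ⟨(mem_regenLevels_iff (by omega) (hit _)).2 hg.2, ?_⟩
      simp; omega
    · obtain ⟨h1, h2⟩ := hmem
      obtain ⟨y, hy⟩ := Int.eq_ofNat_of_zero_le h1.1
      have h3 := (mem_regenLevels_iff h1.1 ⟨m, rfl⟩).1 h1
      rw [hy] at h3 h2
      have : L.gap ≤ y := Nat.sInf_le ⟨by simp at h2; omega, h3⟩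
      have := hlt m hm
      omega
  exact ⟨by rw [key, hn], by rw [regenPos, key]; exact hnx⟩

/-- The cost does not see the arrows at negative sites: if `L` stays then so does `E`, which
therefore never reads them, and otherwise both costs vanish. This makes the one-sided shift
applicable. -/
lemma cost_congr {L' E' : ArrowSystem} (hL : ∀ y, 0 ≤ y → L' y = L y) (hE : ∀ y, 0 ≤ y → E' y = E y)
    (hst : L.Stays → E.Stays) : L'.cost E' = L.cost E := by
  have h1 := stays_congr hL
  have h2 : L'.gap = L.gap := by
    unfold gap
    congr 1
    ext y
    simp only [Set.mem_ofPred_eq, and_congr_right_iff]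
    exact fun _ => stays_congr fun z hz => hL _ (by omega)
  unfold cost
  rw [h2]
  by_cases h : L.Stays
  · rw [if_pos h, if_pos (h1.2 h), (hst h).walk_eq_of_agree fun y hy => (hE y hy).symm]
  · rw [if_neg h, if_neg (h1.not.2 h)]

lemma gapOn_congr {L' : ArrowSystem} (hL : ∀ y, 0 ≤ y → L' y = L y) : L'.gapOn = L.gapOn := by
  have h1 := stays_congr hL
  have h2 : L'.gap = L.gap := by
    unfold gap
    congr 1
    ext y
    simp only [Set.mem_ofPred_eq, and_congr_right_iff]
    exact fun _ => stays_congr fun z hz => hL _ (by omega)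
  unfold gapOn
  rw [h2]
  by_cases h : L.Stays
  · rw [if_pos h, if_pos (h1.2 h)]
  · rw [if_neg h, if_neg (h1.not.2 h)]

end ArrowSystem

end ExcitedRW

/-! ### The pointwise ergodic theorem -/

section Birkhoff

variable {α : Type*} {T : α → α}

/-- The maximum of `0` and of the first `n` Birkhoff sums. -/
noncomputable def maxBirkhoffSum (T : α → α) (g : α → ℝ) : ℕ → α → ℝ
  | 0 => fun _ => 0
  | n + 1 => fun x => max 0 (g x + maxBirkhoffSum T g n (T x))

lemma maxBirkhoffSum_nonneg (g : α → ℝ) (n : ℕ) (x : α) : 0 ≤ maxBirkhoffSum T g n x := by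
  cases n <;> simp [maxBirkhoffSum]

lemma maxBirkhoffSum_le_succ (g : α → ℝ) (n : ℕ) (x : α) :
    maxBirkhoffSum T g n x ≤ maxBirkhoffSum T g (n + 1) x := by
  induction n generalizing x with
  | zero => exact maxBirkhoffSum_nonneg g 1 x
  | succ n ih =>
    exact max_le_max le_rfl (add_le_add le_rfl (ih _))

lemma birkhoffSum_le_maxBirkhoffSum (g : α → ℝ) (n : ℕ) (x : α) :
    birkhoffSum T g n x ≤ maxBirkhoffSum T g n x := by
  induction n generalizing x with
  | zero => simp [maxBirkhoffSum]
  | succ n ih =>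
    rw [birkhoffSum_succ', maxBirkhoffSum]
    exact le_max_of_le_right (by gcongr; exact ih _)

variable [MeasurableSpace α] {μ : Measure α}

lemma measurable_maxBirkhoffSum (hT : Measurable T) {g : α → ℝ} (hg : Measurable g) (n : ℕ) :
    Measurable (maxBirkhoffSum T g n) := by
  induction n with
  | zero => exact measurable_const
  | succ n ih => exact measurable_const.max (hg.add (ih.comp hT))

lemma integrable_maxBirkhoffSum (hT : MeasurePreserving T μ μ) {g : α → ℝ} (hg : Integrable g μ)
    (n : ℕ) : Integrable (maxBirkhoffSum T g n) μ := by
  induction n with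
  | zero => exact integrable_zero _ _ _
  | succ n ih =>
    exact (integrable_zero _ _ _).sup (hg.add (hT.integrable_comp_of_integrable ih))

/-- The maximal ergodic theorem. -/
lemma integral_nonneg_of_birkhoffSum_pos (hT : MeasurePreserving T μ μ) {g : α → ℝ}
    (hgm : Measurable g) (hg : Integrable g μ) (hpos : ∀ᵐ x ∂μ, ∃ n, 0 < birkhoffSum T g n x) :
    0 ≤ ∫ x, g x ∂μ := by
  let s : ℕ → Set α := fun n => {x | 0 < maxBirkhoffSum T g (n + 1) x}
  have hs : ∀ n, MeasurableSet (s n) := fun n =>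
    measurableSet_lt measurable_const (measurable_maxBirkhoffSum hT.measurable hgm _)
  have hmono : Monotone s := monotone_nat_of_le_succ fun n x hx =>
    lt_of_lt_of_le hx (maxBirkhoffSum_le_succ g (n + 1) x)
  have hlim := tendsto_setIntegral_of_monotone (μ := μ) hs hmono hg.integrableOn
  have hU : ∫ x in ⋃ n, s n, g x ∂μ = ∫ x, g x ∂μ := by
    rw [Measure.restrict_eq_self_of_ae_mem]
    filter_upwards [hpos] with x ⟨n, hn⟩
    refine Set.mem_iUnion.2 ⟨n, ?_⟩
    exact hn.trans_le ((birkhoffSum_le_maxBirkhoffSum g n x).trans (maxBirkhoffSum_le_succ g n x))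
  rw [hU] at hlim
  refine ge_of_tendsto' hlim fun n => ?_
  have hi := integrable_maxBirkhoffSum hT hg
  have hcomp : Integrable (fun x => maxBirkhoffSum T g n (T x)) μ :=
    hT.integrable_comp_of_integrable (hi n)
  have heq : ∫ x, maxBirkhoffSum T g n (T x) ∂μ = ∫ x, maxBirkhoffSum T g n x ∂μ := by
    rw [← integral_map (f := maxBirkhoffSum T g n) hT.measurable.aemeasurable, hT.map_eq]
    rw [hT.map_eq]
    exact (hi n).aestronglyMeasurable
  calc 0 ≤ ∫ x, maxBirkhoffSum T g (n + 1) x ∂μ - ∫ x, maxBirkhoffSum T g n (T x) ∂μ := by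
        rw [heq, sub_nonneg]
        exact integral_mono (hi n) (hi (n + 1)) (maxBirkhoffSum_le_succ g n)
    _ = ∫ x, (maxBirkhoffSum T g (n + 1) x - maxBirkhoffSum T g n (T x)) ∂μ :=
        (integral_sub (hi (n + 1)) hcomp).symm
    -- Garsia's argument: where the maximum is positive its defining recursion makes the difference
    -- equal to `g`; elsewhere the first term is `0` and the subtracted one is non-negative.
    _ ≤ ∫ x, (s n).indicator g x ∂μ := by
        refine integral_mono ((hi (n + 1)).sub hcomp) (hg.indicator (hs n)) fun x => ?_
        by_cases hx : x ∈ s n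
        · rw [Set.indicator_of_mem hx]
          have h1 : 0 < max 0 (g x + maxBirkhoffSum T g n (T x)) := hx
          have h2 : max 0 (g x + maxBirkhoffSum T g n (T x)) = g x + maxBirkhoffSum T g n (T x) :=
            max_eq_right (by by_contra! h; rw [max_eq_left h.le] at h1; exact lt_irrefl _ h1)
          simp only [maxBirkhoffSum]
          rw [h2]
          simp
        · rw [Set.indicator_of_notMem hx]
          have h1 : maxBirkhoffSum T g (n + 1) x ≤ 0 := not_lt.1 hx
          have := maxBirkhoffSum_nonneg (T := T) g n (T x)
          linarith
    _ = ∫ x in s n, g x ∂μ := integral_indicator (hs n)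

/-- Boundedness of the sums is invariant under `T`, so it holds almost everywhere or almost nowhere.
In the latter case some sum is almost surely positive, and the maximal ergodic theorem contradicts
the negative mean. -/
lemma ae_bddAbove_birkhoffSum (hT : Ergodic T μ) {g : α → ℝ}
    (hgm : Measurable g) (hg : Integrable g μ) (hneg : ∫ x, g x ∂μ < 0) :
    ∀ᵐ x ∂μ, BddAbove (Set.range fun n => birkhoffSum T g n x) := by
  have hmeas : ∀ n, Measurable (birkhoffSum T g n) := fun n =>
    Finset.measurable_sum _ fun i _ => hgm.comp (hT.measurable.iterate i)
  have hset : MeasurableSet {x | BddAbove (Set.range fun n => birkhoffSum T g n x)} :=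
    measurableSet_bddAbove_range hmeas
  refine (hT.ae_mem_or_ae_notMem hset ?_).resolve_right fun hcon => ?_
  · ext x
    change BddAbove (Set.range fun n => birkhoffSum T g n (T x)) ↔
      BddAbove (Set.range fun n => birkhoffSum T g n x)
    constructor
    · rintro ⟨C, hC⟩
      refine ⟨max 0 (g x + C), ?_⟩
      rintro _ ⟨n, rfl⟩
      cases n with
      | zero => simp
      | succ n =>
        simp only [birkhoffSum_succ']
        exact le_max_of_le_right (by gcongr; exact hC ⟨n, rfl⟩)
    · rintro ⟨C, hC⟩
      refine ⟨C - g x, ?_⟩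
      rintro _ ⟨n, rfl⟩
      have := hC ⟨n + 1, rfl⟩
      simp only [birkhoffSum_succ'] at this ⊢
      linarith
  · refine absurd (integral_nonneg_of_birkhoffSum_pos hT.toMeasurePreserving hgm hg ?_)
      (not_le.2 hneg)
    filter_upwards [hcon] with x hx
    by_contra! h
    refine hx ⟨0, ?_⟩
    rintro _ ⟨n, rfl⟩
    exact h n

lemma ae_birkhoffSum_le (hT : Ergodic T μ) [IsProbabilityMeasure μ] {f : α → ℝ}
    (hfm : Measurable f) (hf : Integrable f μ) {ε : ℝ} (hε : 0 < ε) :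
    ∀ᵐ x ∂μ, ∃ C, ∀ n : ℕ, birkhoffSum T f n x ≤ n * (∫ y, f y ∂μ + ε) + C := by
  have h := ae_bddAbove_birkhoffSum hT (g := fun x => f x - (∫ y, f y ∂μ + ε))
    (hfm.sub measurable_const) (hf.sub (integrable_const _)) (by
      rw [integral_sub hf (integrable_const _)]; simp; exact hε)
  filter_upwards [h] with x ⟨C, hC⟩
  refine ⟨C, fun n => ?_⟩
  have := hC ⟨n, rfl⟩
  simp only [birkhoffSum, Finset.sum_sub_distrib, Finset.sum_const, Finset.card_range,
    nsmul_eq_mul] at this ⊢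
  linarith

theorem ae_tendsto_birkhoffSum_div (hT : Ergodic T μ) [IsProbabilityMeasure μ] {f : α → ℝ}
    (hfm : Measurable f) (hf : Integrable f μ) :
    ∀ᵐ x ∂μ, Tendsto (fun n : ℕ => birkhoffSum T f n x / n) atTop (𝓝 (∫ y, f y ∂μ)) := by
  have h1 : ∀ᵐ x ∂μ, ∀ k : ℕ, ∃ C, ∀ n : ℕ, birkhoffSum T f n x ≤
      n * (∫ y, f y ∂μ + 1 / ((k : ℝ) + 1)) + C :=
    ae_all_iff.2 fun k => ae_birkhoffSum_le hT hfm hf (by positivity)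
  have h2 : ∀ᵐ x ∂μ, ∀ k : ℕ, ∃ C, ∀ n : ℕ, birkhoffSum T (-f) n x ≤
      n * (∫ y, (-f) y ∂μ + 1 / ((k : ℝ) + 1)) + C :=
    ae_all_iff.2 fun k => ae_birkhoffSum_le hT hfm.neg hf.neg (by positivity)
  filter_upwards [h1, h2] with x hx1 hx2
  rw [Metric.tendsto_atTop]
  intro ε hε
  obtain ⟨k, hk⟩ := exists_nat_one_div_lt (half_pos hε)
  obtain ⟨C1, hC1⟩ := hx1 k
  obtain ⟨C2, hC2⟩ := hx2 k
  obtain ⟨N, hN⟩ := exists_nat_gt (2 * max |C1| |C2| / ε)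
  refine ⟨N + 1, fun n hn => ?_⟩
  have hn0 : (0 : ℝ) < n := by
    have : 0 < n := by omega
    exact_mod_cast this
  have hCn : max |C1| |C2| < n * (ε / 2) := by
    have : (N : ℝ) < n := by exact_mod_cast hn
    rw [div_lt_iff₀ hε] at hN
    nlinarith
  have hb1 := hC1 n
  have hb2 := hC2 n
  rw [birkhoffSum_neg] at hb2
  simp only [Pi.neg_apply, integral_neg] at hb2
  have hc1 := (le_abs_self C1).trans (le_max_left |C1| |C2|)
  have hc2 := (le_abs_self C2).trans (le_max_right |C1| |C2|)
  have hkn := mul_lt_mul_of_pos_left hk hn0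
  rw [Real.dist_eq, abs_lt]
  constructor
  · rw [lt_sub_iff_add_lt, lt_div_iff₀ hn0]
    nlinarith
  · rw [sub_lt_iff_lt_add, div_lt_iff₀ hn0]
    nlinarith

lemma ae_tendsto_birkhoffSum_div_of_lintegral_ne_top (hT : Ergodic T μ) [IsProbabilityMeasure μ]
    {f : α → ℝ≥0∞} (hfm : Measurable f) (hf : ∫⁻ x, f x ∂μ ≠ ∞) :
    ∀ᵐ x ∂μ, Tendsto (fun n : ℕ => birkhoffSum T f n x / n) atTop (𝓝 (∫⁻ y, f y ∂μ)) := by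
  have hlt : ∀ᵐ x ∂μ, f x ≠ ∞ := (ae_lt_top hfm hf).mono fun x hx => hx.ne
  have horb : ∀ᵐ x ∂μ, ∀ i : ℕ, f (T^[i] x) ≠ ∞ := ae_all_iff.2 fun i =>
    (hT.toMeasurePreserving.iterate i).quasiMeasurePreserving.ae hlt
  have h := ae_tendsto_birkhoffSum_div hT hfm.ennreal_toReal
    (integrable_toReal_of_lintegral_ne_top hfm.aemeasurable hf)
  rw [integral_toReal hfm.aemeasurable (ae_lt_top hfm hf)] at h
  filter_upwards [horb, h] with x hx hlim
  have h2 := ENNReal.tendsto_ofReal hlim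
  rw [ENNReal.ofReal_toReal hf] at h2
  refine h2.congr' ?_
  filter_upwards [eventually_gt_atTop 0] with n hn
  rw [ENNReal.ofReal_div_of_pos (by exact_mod_cast hn), ENNReal.ofReal_natCast]
  congr 1
  unfold birkhoffSum
  rw [ENNReal.ofReal_sum_of_nonneg fun i _ => ENNReal.toReal_nonneg]
  exact Finset.sum_congr rfl fun i _ => ENNReal.ofReal_toReal (hx i)

/-- The pointwise ergodic theorem for functions with values in `[0, ∞]`. -/
theorem ae_tendsto_birkhoffSum_div_lintegral (hT : Ergodic T μ) [IsProbabilityMeasure μ]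
    {f : α → ℝ≥0∞} (hfm : Measurable f) :
    ∀ᵐ x ∂μ, Tendsto (fun n : ℕ => birkhoffSum T f n x / n) atTop (𝓝 (∫⁻ y, f y ∂μ)) := by
  by_cases hf : ∫⁻ x, f x ∂μ = ∞
  swap
  · exact ae_tendsto_birkhoffSum_div_of_lintegral_ne_top hT hfm hf
  -- For an infinite integral, the averages are bounded below by those of the truncations, whose
  -- means increase to `∞`.
  have htr : ∀ᵐ x ∂μ, ∀ k : ℕ, Tendsto (fun n : ℕ => birkhoffSum T (fun y => min (f y) k) n x / n)
      atTop (𝓝 (∫⁻ y, min (f y) k ∂μ)) := by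
    refine ae_all_iff.2 fun k => ae_tendsto_birkhoffSum_div_of_lintegral_ne_top hT
      (hfm.min measurable_const) (ne_top_of_le_ne_top (b := (k : ℝ≥0∞)) (by simp) ?_)
    calc ∫⁻ y, min (f y) k ∂μ ≤ ∫⁻ _, (k : ℝ≥0∞) ∂μ := lintegral_mono fun y => min_le_right _ _
      _ = k := by simp
  have hsup : ⨆ k : ℕ, ∫⁻ y, min (f y) k ∂μ = ∞ := by
    rw [← lintegral_iSup (fun k => hfm.min measurable_const) (fun i j hij y => by
      simp only; gcongr), ← hf]
    refine lintegral_congr fun y => ?_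
    rw [← inf_iSup_eq, ENNReal.iSup_natCast, inf_top_eq]
  filter_upwards [htr] with x hx
  rw [hf, ENNReal.tendsto_nhds_top_iff_nnreal]
  intro c
  obtain ⟨k, hk⟩ := lt_iSup_iff.1 (hsup ▸ ENNReal.coe_lt_top : (c : ℝ≥0∞) < _)
  filter_upwards [(hx k).eventually_const_lt hk] with n hn
  refine hn.trans_le ?_
  gcongr
  exact Finset.sum_le_sum fun i _ => min_le_left _ _

end Birkhoff

/-! ### Ergodicity of the one-sided Bernoulli shift -/

section Shift

variable {S : Type*}

lemma iterate_shift (η : ℕ → S) (n i : ℕ) :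
    (fun (η : ℕ → S) i => η (i + 1))^[n] η i = η (n + i) := by
  induction n generalizing η with
  | zero => simp
  | succ n ih => rw [Function.iterate_succ_apply, ih]; congr 1; omega

variable [MeasurableSpace S] (μ : Measure S) [IsProbabilityMeasure μ]

/-- An invariant set equals its preimage under the `n`-th iterate, which depends only on the
coordinates from `n` on. It is thus a tail event, and Kolmogorov's zero-one law applies. -/
theorem ergodic_shift : Ergodic (fun (η : ℕ → S) i => η (i + 1))
    (Measure.infinitePi fun _ : ℕ => μ) where
  measurable := by fun_prop
  map_eq := Measure.map_infinitePi_infinitePi_of_inj (P := fun _ : ℕ => μ) (f := fun i => i + 1)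
    (add_left_injective 1)
  aeconst_set := by
    intro t ht hinv
    let m : ℕ → MeasurableSpace (ℕ → S) := fun i => MeasurableSpace.comap (fun η => η i) inferInstance
    have hind : iIndep m (Measure.infinitePi fun _ : ℕ => μ) :=
      iIndepFun_infinitePi (P := fun _ : ℕ => μ) (X := fun _ s => s) fun _ => measurable_id
    have htail : MeasurableSet[limsup m atTop] t := by
      rw [limsup_eq_iInf_iSup_of_nat', MeasurableSpace.measurableSet_iInf]
      intro n
      have hpre : (fun (η : ℕ → S) i => η (i + 1))^[n] ⁻¹' t = t :=
        Function.IsFixedPt.preimage_iterate hinv n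
      rw [← hpre]
      have hmeas : Measurable[⨆ i, m (i + n)] ((fun (η : ℕ → S) i => η (i + 1))^[n]) := by
        refine @measurable_pi_lambda _ _ _ (⨆ i, m (i + n)) _ _ fun i => ?_
        simp only [iterate_shift]
        refine Measurable.mono (comap_measurable _) ?_ le_rfl
        rw [add_comm n i]
        exact le_iSup (fun i => m (i + n)) i
      exact hmeas ht
    have := measure_zero_or_one_of_measurableSet_limsup_atTop
      (fun i => (measurable_pi_apply i).comap_le) hind htail
    rw [eventuallyConst_set']
    rcases this with h | h
    · exact Or.inl (ae_eq_empty.2 h)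
    · right
      rw [ae_eq_univ, prob_compl_eq_zero_iff ht, h]

end Shift

/-! ### The law of the walk of an arrow system with independent arrows -/

instance : DiscreteMeasurableSpace ℤˣ :=
  ⟨fun s => ⟨Units.val '' s, trivial, Set.preimage_image_eq s Units.val_injective⟩⟩

lemma measurable_eval_countable {Ω ι β : Type*} [MeasurableSpace Ω] [MeasurableSpace β]
    [MeasurableSpace ι] [Countable ι] [MeasurableSingletonClass ι] {f : ι → Ω → β}
    (hf : ∀ i, Measurable (f i)) {a : Ω → ι} (ha : Measurable a) :
    Measurable fun ω => f (a ω) ω :=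
  (measurable_from_prod_countable_right (f := fun q : ι × Ω => f q.1 q.2) hf).comp
    (ha.prodMk measurable_id)

namespace ExcitedRW

namespace ArrowSystem

lemma measurable_arrow (x : ℤ) (k : ℕ) : Measurable fun E : ArrowSystem => E x k :=
  (measurable_pi_apply k).comp (measurable_pi_apply x)

lemma measurable_walk_dep (n : ℕ) :
    (Measurable fun E : ArrowSystem => E.walk n) ∧
      ∀ x, Measurable fun E : ArrowSystem => E.dep n x := by
  induction n with
  | zero => exact ⟨measurable_const, fun x => measurable_const⟩
  | succ n ih =>
    have hd : Measurable fun E : ArrowSystem => E.dep n (E.walk n) :=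
      measurable_eval_countable (f := fun x (E : ArrowSystem) => E.dep n x) ih.2 ih.1
    constructor
    · simp only [walk_succ_dep]
      refine ih.1.add ((measurable_of_countable (fun e : ℤˣ => (e : ℤ))).comp ?_)
      exact measurable_eval_countable (f := fun (i : ℤ × ℕ) (E : ArrowSystem) => E i.1 i.2)
        (fun i => measurable_arrow i.1 i.2) (ih.1.prodMk hd)
    · intro x
      simp only [dep_succ, Function.update_apply]
      exact Measurable.ite (measurableSet_eq_fun measurable_const ih.1)
        (hd.add measurable_const) (ih.2 x)

lemma measurable_walk : Measurable ArrowSystem.walk :=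
  measurable_pi_lambda _ fun n => (measurable_walk_dep n).1

end ArrowSystem

/-- The number of visits of the path `g` to `g m` strictly before time `m`. -/
def visits (g : ℕ → ℤ) (m : ℕ) : ℕ := ((Finset.range m).filter fun j => g j = g m).card

/-- A path never uses the same arrow twice; hence the steps along a prescribed path involve
independent arrows. -/
lemma injective_visits (g : ℕ → ℤ) : Function.Injective fun m => (g m, visits g m) := by
  intro m m' h
  wlog hlt : m < m' generalizing m m'
  · rcases (not_lt.1 hlt).lt_or_eq with h' | h'
    · exact (this h.symm h').symm
    · exact h'.symm
  exfalso
  simp only [Prod.mk.injEq] at h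
  refine absurd h.2 (Nat.ne_of_lt (Finset.card_lt_card ?_))
  rw [Finset.ssubset_iff]
  refine ⟨m, by simp, fun j hj => ?_⟩
  simp only [Finset.mem_insert, Finset.mem_filter, Finset.mem_range] at hj ⊢
  rcases hj with rfl | hj
  · exact ⟨hlt, h.1⟩
  · exact ⟨hj.1.trans hlt, hj.2.trans h.1⟩

/-- Along a fixed path the arrows consulted are deterministic indices, so a cylinder event becomes a
finite list of conditions on single arrows. -/
lemma ArrowSystem.walk_eq_iff (E : ArrowSystem) (g : ℕ → ℤ) (n : ℕ) :
    (∀ m ≤ n, E.walk m = g m) ↔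
      g 0 = 0 ∧ ∀ m ∈ Finset.range n, g m + (E (g m) (visits g m) : ℤ) = g (m + 1) := by
  induction n with
  | zero => simp [walk_zero, eq_comm]
  | succ n ih =>
    rw [Finset.range_add_one]
    simp only [Finset.mem_insert, forall_eq_or_imp]
    rw [and_left_comm, ← ih]
    constructor
    · intro h
      have hv : ((Finset.range n).filter fun m => E.walk m = E.walk n).card = visits g n := by
        rw [visits, h n (by omega)]
        congr 1
        refine Finset.filter_congr fun j hj => ?_
        rw [h j (by have := Finset.mem_range.1 hj; omega)]
      have hs := E.walk_succ n
      rw [hv, h n (by omega), h (n + 1) le_rfl] at hs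
      exact ⟨hs.symm, fun m hm => h m (by omega)⟩
    · rintro ⟨h1, h⟩ m hm
      rcases Nat.of_le_succ hm with hm | rfl
      · exact h m hm
      have hv : ((Finset.range n).filter fun m => E.walk m = E.walk n).card = visits g n := by
        rw [visits, h n (by omega)]
        congr 1
        refine Finset.filter_congr fun j hj => ?_
        rw [h j (by have := Finset.mem_range.1 hj; omega)]
      rw [E.walk_succ, hv, h n le_rfl, ← h1]

open Preorder in
lemma earlierVisits_frestrictLe (g : ℕ → ℤ) (n : ℕ) :
    earlierVisits n (frestrictLe n g) = visits g n := by
  unfold earlierVisits visits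
  refine Finset.card_bij (fun i _ => (i : ℕ)) ?_ ?_ ?_
  · intro i hi
    simpa using (Finset.mem_filter.1 hi).2
  · intro i _ j _ h
    exact Subtype.ext h
  · intro j hj
    simp only [Finset.mem_filter, Finset.mem_range] at hj
    exact ⟨⟨j, Finset.mem_Iic.2 hj.1.le⟩, Finset.mem_filter.2 ⟨Finset.mem_univ _, by simpa using hj⟩, rfl⟩

open Preorder Kernel in
lemma partialTraj_succ_singleton (κ : (n : ℕ) → Kernel ((i : Finset.Iic n) → ℤ) ℤ)
    [∀ n, IsMarkovKernel (κ n)] (x₀ : (i : Finset.Iic 0) → ℤ) (g : ℕ → ℤ) (n : ℕ) :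
    partialTraj (X := fun _ => ℤ) κ 0 (n + 1) x₀ {frestrictLe (n + 1) g} =
      partialTraj (X := fun _ => ℤ) κ 0 n x₀ {frestrictLe n g} *
        κ n (frestrictLe n g) {g (n + 1)} := by
  have hms : MeasurableSet (IicProdIoc (X := fun _ : ℕ => ℤ) n (n + 1) ⁻¹' {frestrictLe (n + 1) g}) :=
    measurable_IicProdIoc (measurableSet_singleton _)
  -- Extending a history `y` by one step can produce the given history only if `y` is its
  -- restriction.
  have hy : ∀ y : (i : Finset.Iic n) → ℤ,
      ((Kernel.id ×ₖ (κ n).map (MeasurableEquiv.piSingleton (X := fun _ : ℕ => ℤ) n)) y)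
        (IicProdIoc (X := fun _ : ℕ => ℤ) n (n + 1) ⁻¹' {frestrictLe (n + 1) g}) =
      ({frestrictLe n g} : Set ((i : Finset.Iic n) → ℤ)).indicator
        (fun _ => κ n (frestrictLe n g) {g (n + 1)}) y := by
    intro y
    rw [Kernel.id_prod_apply' _ _ hms,
      Kernel.map_apply' _ (MeasurableEquiv.measurable _) _ (measurable_prodMk_left hms)]
    by_cases h : y = frestrictLe n g
    · rw [Set.indicator_of_mem (by exact h), h]
      congr 1
      ext z
      simp only [Set.mem_preimage, Set.mem_singleton_iff]
      constructor
      · intro hz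
        have := congrFun hz ⟨n + 1, by simp⟩
        simpa [IicProdIoc, MeasurableEquiv.piSingleton] using this
      · rintro rfl
        funext i
        by_cases hi : (i : ℕ) ≤ n
        · simp [IicProdIoc, hi]
        · have hi' : (i : ℕ) = n + 1 := by
            have := Finset.mem_Iic.1 i.2
            omega
          obtain ⟨i, hi2⟩ := i
          simp only at hi'
          subst hi'
          simp [IicProdIoc, MeasurableEquiv.piSingleton]
    · rw [Set.indicator_of_notMem (by exact h)]
      convert measure_empty (μ := κ n y)
      ext z
      simp only [Set.mem_preimage, Set.mem_singleton_iff, Set.mem_empty_iff_false, iff_false]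
      intro hz
      apply h
      funext i
      have hi := Finset.mem_Iic.1 i.2
      have := congrFun hz ⟨i, Finset.mem_Iic.2 (by omega)⟩
      simpa [IicProdIoc, hi] using this
  rw [partialTraj_succ_of_le (Nat.zero_le n), Kernel.map_apply' _ (by fun_prop) _
    (measurableSet_singleton _), Kernel.comp_apply' _ _ _ hms]
  simp_rw [hy]
  rw [lintegral_indicator_const (measurableSet_singleton _), mul_comm]

variable {Ω : Type*} [MeasurableSpace Ω] {P : Measure Ω} {p : CookieEnv} {E : Ω → ArrowSystem}

open Preorder in
lemma measure_arrow_step (hlaw : ∀ x k, HasLaw (fun ω => E ω x k)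
    (bernoulliMeasure 1 (-1) (p.prob k)) P) (g : ℕ → ℤ) (n : ℕ) :
    P ((fun ω => E ω (g n) (visits g n)) ⁻¹' {e : ℤˣ | g n + (e : ℤ) = g (n + 1)}) =
      erwStep p n (frestrictLe n g) {g (n + 1)} := by
  have h1 : erwStep p n (frestrictLe n g) =
      (bernoulliMeasure (1 : ℤˣ) (-1) (p.prob (visits g n))).map (fun e : ℤˣ => g n + (e : ℤ)) := by
    rw [map_bernoulliMeasure]
    change bernoulliMeasure _ _ (p.prob (earlierVisits n (frestrictLe n g))) = _
    rw [earlierVisits_frestrictLe]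
    rfl
  rw [h1, Measure.map_apply (measurable_of_countable _) (measurableSet_singleton _),
    ← (hlaw (g n) (visits g n)).map_eq,
    Measure.map_apply_of_aemeasurable (hlaw (g n) (visits g n)).aemeasurable
      (MeasurableSet.of_discrete)]
  rfl

open Preorder Kernel in
/-- The walk along independent arrows is an excited random walk. -/
theorem hasLaw_walk [IsProbabilityMeasure P] (hE : Measurable E)
    (hind : iIndepFun (fun (i : ℤ × ℕ) ω => E ω i.1 i.2) P)
    (hlaw : ∀ x k, HasLaw (fun ω => E ω x k) (bernoulliMeasure 1 (-1) (p.prob k)) P) :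
    HasLaw (fun ω => (E ω).walk) (erwLaw p) P := by
  have hw : Measurable fun ω => (E ω).walk := ArrowSystem.measurable_walk.comp hE
  refine ⟨hw.aemeasurable, ?_⟩
  have hcyl : ∀ (n : ℕ) (g : ℕ → ℤ), P {ω | ∀ m ≤ n, (E ω).walk m = g m} =
      partialTraj (X := fun _ => ℤ) (erwStep p) 0 n (fun _ => 0) {frestrictLe n g} := by
    intro n g
    have hset : {ω | ∀ m ≤ n, (E ω).walk m = g m} = {ω | g 0 = 0 ∧
        ∀ m ∈ Finset.range n, g m + (E ω (g m) (visits g m) : ℤ) = g (m + 1)} := by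
      ext ω
      exact (E ω).walk_eq_iff g n
    have hprod : partialTraj (X := fun _ => ℤ) (erwStep p) 0 n (fun _ => 0) {frestrictLe n g} =
        (if g 0 = 0 then 1 else 0) *
          ∏ m ∈ Finset.range n, erwStep p m (frestrictLe m g) {g (m + 1)} := by
      clear hset
      induction n with
      | zero =>
        rw [partialTraj_self, Kernel.id_apply, Measure.dirac_apply' _ (measurableSet_singleton _)]
        simp only [Finset.range_zero, Finset.prod_empty, mul_one, Set.indicator_apply]
        refine if_congr ?_ rfl rfl
        rw [Set.mem_singleton_iff, funext_iff]
        constructor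
        · intro h
          exact (h ⟨0, by simp⟩).symm
        · rintro h ⟨i, hi⟩
          obtain rfl : i = 0 := by simpa using hi
          exact h.symm
      | succ n ih =>
        rw [partialTraj_succ_singleton, ih, Finset.prod_range_succ, mul_assoc]
    rw [hset, hprod]
    by_cases h0 : g 0 = 0
    · rw [if_pos h0, one_mul]
      have := (hind.precomp (injective_visits g)).measure_inter_preimage_eq_mul (Finset.range n)
        (sets := fun m => {e : ℤˣ | g m + (e : ℤ) = g (m + 1)}) fun _ _ => MeasurableSet.of_discrete
      rw [Finset.prod_congr rfl fun m _ => measure_arrow_step hlaw g m] at this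
      rw [← this]
      congr 1
      ext ω
      simp [h0]
    · simp [h0]
  have hfin : ∀ n, IsProbabilityMeasure
      (partialTraj (X := fun _ => ℤ) (erwStep p) 0 n (fun _ => 0)) := fun n => inferInstance
  have hfin' : ∀ I, IsFiniteMeasure
      (inducedFamily (X := fun _ => ℤ) 
        (fun n => partialTraj (X := fun _ => ℤ) (erwStep p) 0 n (fun _ => 0)) I) :=
    fun I => inferInstance
  refine ((isProjectiveLimit_trajFun (X := fun _ => ℤ) (erwStep p) 0 (fun _ => 0)).unique ?_).symm
  refine (isProjectiveLimit_nat_iff (isProjectiveMeasureFamily_partialTraj _ _) _).2 fun n => ?_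
  -- Finite histories form a countable space, so the cylinder masses determine the law.
  rw [inducedFamily_Iic, Measure.ext_iff_singleton]
  intro h
  obtain ⟨g, rfl⟩ : ∃ g : ℕ → ℤ, frestrictLe n g = h :=
    ⟨fun m => if hm : m ≤ n then h ⟨m, Finset.mem_Iic.2 hm⟩ else 0, by
      funext i
      simp [Finset.mem_Iic.1 i.2]⟩
  rw [Measure.map_map (by fun_prop) hw, Measure.map_apply (by fun_prop) (measurableSet_singleton _),
    ← hcyl]
  congr 1
  ext ω
  simp only [Set.mem_preimage, Function.comp_apply, Set.mem_singleton_iff, funext_iff]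
  constructor
  · intro hh m hm
    exact hh ⟨m, Finset.mem_Iic.2 hm⟩
  · rintro hh ⟨m, hm⟩
    exact hh m (Finset.mem_Iic.1 hm)

end ExcitedRW

/-! ### A transient walk never backtracks with positive probability -/

namespace ExcitedRW

namespace ArrowSystem

/-- The arrow system obtained by turning the first `M` arrows at `0` to the right. -/
def forced (E : ArrowSystem) (M : ℕ) : ArrowSystem :=
  fun x k => if x = 0 ∧ k < M then 1 else E x k

lemma le_forced (E : ArrowSystem) (M : ℕ) : E.Le (E.forced M) := by
  intro x k
  refine Finset.sum_le_sum fun j _ => ?_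
  unfold forced
  split_ifs with h
  · rcases Int.units_eq_one_or (E x j) with h | h <;> simp [h]
  · exact le_rfl

/-- A transient walk leaves `0` a bounded number of times. By comparison the forced walk, up to its
first step to `-1`, leaves `0` no more often, so with enough forced arrows that step would have to
follow an arrow pointing right. -/
lemma exists_forced_stays {E : ArrowSystem} (h : Tendsto E.walk atTop atTop) :
    ∃ M, (E.forced M).Stays := by
  obtain ⟨n₀, hn₀⟩ := eventually_atTop.1 (h.eventually_ge_atTop 1)
  have hdep : ∀ n, E.dep n 0 ≤ n₀ := by
    intro n
    induction n with
    | zero => simp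
    | succ n ih =>
      by_cases hn : n < n₀
      · exact (E.dep_le _ _).trans hn
      · rw [dep_succ_of_ne _ (by have := hn₀ n (not_lt.1 hn); omega)]
        exact ih
  refine ⟨n₀ + 1, ?_⟩
  unfold Stays
  by_contra! hcon
  classical
  obtain ⟨n, hn, hmin⟩ : ∃ n, (E.forced (n₀ + 1)).walk n = -1 ∧
      ∀ i < n, (E.forced (n₀ + 1)).walk i ≠ -1 :=
    ⟨Nat.find hcon, Nat.find_spec hcon, fun i hi => Nat.find_min hcon hi⟩
  cases n with
  | zero => simp [walk_zero] at hn
  | succ k =>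
    have h0 := nonneg_of_ne_neg_one hmin k (by omega)
    have hk : (E.forced (n₀ + 1)).walk k = 0 := by
      rcases (E.forced (n₀ + 1)).walk_succ_eq_or k with h' | h' <;> omega
    -- Within `k` steps the forced walk cannot exceed `k`, hence it stays left of `E.walk t`, as the
    -- comparison requires.
    obtain ⟨t, ht⟩ := (h.eventually_gt_atTop (k : ℤ)).exists
    have hle := (E.le_forced (n₀ + 1)).dep_le_dep (n := k) (t := t) (fun m hm => by
      have := (abs_le.1 ((E.forced (n₀ + 1)).abs_walk_le m)).2
      omega) 0
    have := hdep t
    rw [walk_succ_dep, hk, forced, if_pos ⟨rfl, by omega⟩] at hn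
    simp at hn

lemma measurableSet_stays : MeasurableSet {E : ArrowSystem | E.Stays} := by
  have : {E : ArrowSystem | E.Stays} = ⋂ n, {E : ArrowSystem | E.walk n = -1}ᶜ := by
    ext E
    simp [Stays]
  rw [this]
  exact MeasurableSet.iInter fun n =>
    (measurableSet_eq_fun (measurable_walk_dep n).1 measurable_const).compl

end ArrowSystem

variable {Ω : Type*} [MeasurableSpace Ω] {P : Measure Ω} {p : CookieEnv} {E : Ω → ArrowSystem}

/-- Some `M` makes the forced walk stay with positive probability. That event ignores the first `M`
arrows at `0`, so it is independent of these all pointing right, which has positive probability by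
ellipticity; on the intersection forcing changes nothing. -/
theorem measure_stays_ne_zero [IsProbabilityMeasure P] (hE : Measurable E)
    (hind : iIndepFun (fun (i : ℤ × ℕ) ω => E ω i.1 i.2) P)
    (hlaw : ∀ x k, HasLaw (fun ω => E ω x k) (bernoulliMeasure 1 (-1) (p.prob k)) P)
    (htr : ∀ᵐ ω ∂P, Tendsto (E ω).walk atTop atTop) : P {ω | (E ω).Stays} ≠ 0 := by
  obtain ⟨M, hM⟩ : ∃ M, P {ω | ((E ω).forced M).Stays} ≠ 0 := by
    by_contra! hcon
    have h0 : ∀ᵐ ω ∂P, ∀ M, ¬ ((E ω).forced M).Stays :=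
      ae_all_iff.2 fun M => measure_eq_zero_iff_ae_notMem.1 (hcon M)
    have hF : ∀ᵐ ω ∂P, False := by
      filter_upwards [h0, htr] with ω h1 h2
      obtain ⟨M, hM⟩ := ArrowSystem.exists_forced_stays h2
      exact h1 M hM
    exact IsProbabilityMeasure.ne_zero P (by simpa using hF)
  let m : ℤ × ℕ → MeasurableSpace Ω := fun i =>
    MeasurableSpace.comap (fun ω => E ω i.1 i.2) inferInstance
  let S : Set (ℤ × ℕ) := {i | i.1 = 0 ∧ i.2 < M}
  have hm : ∀ i, m i ≤ ‹MeasurableSpace Ω› := fun i =>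
    ((ArrowSystem.measurable_arrow i.1 i.2).comp hE).comap_le
  have hindep := indep_iSup_of_disjoint hm hind (disjoint_compl_right : Disjoint S Sᶜ)
  have hA : MeasurableSet[⨆ i ∈ S, m i]
      (⋂ j ∈ Finset.range M, (fun ω => E ω 0 j) ⁻¹' {1}) := by
    refine MeasurableSet.biInter (Finset.range M).countable_toSet fun j hj => ?_
    have hj' : ((0 : ℤ), j) ∈ S := ⟨rfl, Finset.mem_range.1 hj⟩
    exact le_iSup₂ (f := fun i (_ : i ∈ S) => m i) _ hj' _
      ⟨{1}, measurableSet_singleton _, rfl⟩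
  have hB : MeasurableSet[⨆ i ∈ Sᶜ, m i] {ω | ((E ω).forced M).Stays} := by
    have hf : Measurable[⨆ i ∈ Sᶜ, m i] fun ω => (E ω).forced M := by
      refine @measurable_pi_lambda _ _ _ (⨆ i ∈ Sᶜ, m i) _ _ fun x => ?_
      refine @measurable_pi_lambda _ _ _ (⨆ i ∈ Sᶜ, m i) _ _ fun k => ?_
      by_cases hx : x = 0 ∧ k < M
      · simp only [ArrowSystem.forced, if_pos hx]
        exact @measurable_const _ _ _ (⨆ i ∈ Sᶜ, m i) _
      · simp only [ArrowSystem.forced, if_neg hx]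
        exact (comap_measurable fun ω => E ω x k).mono
          (le_iSup₂ (f := fun i (_ : i ∈ Sᶜ) => m i) (x, k) hx) le_rfl
    exact hf ArrowSystem.measurableSet_stays
  have hAB := (Indep_iff _ _ _).1 hindep _ _ hA hB
  have hPA : P (⋂ j ∈ Finset.range M, (fun ω => E ω 0 j) ⁻¹' {1}) ≠ 0 := by
    have hprod := (hind.precomp (g := fun j : ℕ => ((0 : ℤ), j)) (by
      intro i j h; simpa using h)).measure_inter_preimage_eq_mul (Finset.range M)
      (sets := fun _ => {1}) fun _ _ => measurableSet_singleton _
    rw [hprod, Finset.prod_ne_zero_iff]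
    intro j _
    have := (hlaw 0 j)
    rw [← Measure.map_apply_of_aemeasurable this.aemeasurable (measurableSet_singleton _),
      this.map_eq, bernoulliMeasure_apply_of_mem_of_notMem _ (measurableSet_singleton _) rfl
        (by decide)]
    have hp := (p j).2.1
    intro h0
    rw [ENNReal.coe_eq_zero] at h0
    have : ((p j : ℝ)) = 0 := congrArg NNReal.toReal h0
    exact hp.ne' this
  refine fun h0 => mul_ne_zero hPA hM ?_
  rw [← hAB]
  refine measure_mono_null ?_ h0
  rintro ω ⟨h1, h2⟩
  simp only [Set.mem_iInter, Finset.mem_range, Set.mem_preimage, Set.mem_singleton_iff] at h1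
  have : (E ω).forced M = E ω := by
    funext x k
    unfold ArrowSystem.forced
    split_ifs with h
    · rw [h.1, h1 k h.2]
    · rfl
  change ((E ω).forced M).Stays at h2
  rwa [this] at h2

end ExcitedRW

/-! ### The coupling -/

namespace ExcitedRW

/-- The arrow with value `1` if `y = 1` and `-1` otherwise. -/
def arrowOfNat (y : ℕ) : ℤˣ := if y = 1 then 1 else -1

lemma exists_stack_coupling {p q : CookieEnv} (h : Precedes p q) :
    ∃ μ : Measure ((ℕ → ℤˣ) × (ℕ → ℤˣ)), IsProbabilityMeasure μ ∧
      μ.map Prod.fst = Measure.infinitePi (fun k => bernoulliMeasure 1 (-1) (p.prob k)) ∧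
      μ.map Prod.snd = Measure.infinitePi (fun k => bernoulliMeasure 1 (-1) (q.prob k)) ∧
      ∀ᵐ s ∂μ, ∀ k : ℕ,
        ∑ j ∈ Finset.range k, (s.1 j : ℤ) ≤ ∑ j ∈ Finset.range k, (s.2 j : ℤ) := by
  obtain ⟨Ω, _, P, _, Y, Z, hYi, hY, hZi, hZ, hle, -⟩ := h
  have hm : Measurable arrowOfNat := measurable_of_countable _
  have hlaw : ∀ (r : CookieEnv) (W : ℕ → Ω → ℕ), iIndepFun W P →
      (∀ j, HasLaw (W j) (bernoulliMeasure 1 0 (r.prob j)) P) →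
      HasLaw (fun ω j => arrowOfNat (W j ω))
        (Measure.infinitePi fun k => bernoulliMeasure 1 (-1) (r.prob k)) P := by
    intro r W hi hW
    refine iIndepFun.hasLaw_infinitePi (X := fun j ω => arrowOfNat (W j ω)) (fun j => ?_)
      (hi.comp (fun _ => arrowOfNat) fun _ => hm)
      (aemeasurable_pi_lambda _ fun j => hm.comp_aemeasurable (hW j).aemeasurable)
    refine HasLaw.comp (Y := arrowOfNat) ⟨hm.aemeasurable, ?_⟩ (hW j)
    rw [map_bernoulliMeasure]
    rfl
  have hLY := hlaw p Y hYi hY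
  have hLZ := hlaw q Z hZi hZ
  have hpair := hLY.aemeasurable.prodMk hLZ.aemeasurable
  refine ⟨P.map fun ω => (fun j => arrowOfNat (Y j ω), fun j => arrowOfNat (Z j ω)),
    Measure.isProbabilityMeasure_map hpair, ?_, ?_, ?_⟩
  · rw [AEMeasurable.map_map_of_aemeasurable measurable_fst.aemeasurable hpair]
    exact hLY.map_eq
  · rw [AEMeasurable.map_map_of_aemeasurable measurable_snd.aemeasurable hpair]
    exact hLZ.map_eq
  have h01 : ∀ (r : CookieEnv) (W : ℕ → Ω → ℕ),
      (∀ j, HasLaw (W j) (bernoulliMeasure 1 0 (r.prob j)) P) →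
      ∀ᵐ ω ∂P, ∀ j, W j ω = 0 ∨ W j ω = 1 := by
    intro r W hW
    refine ae_all_iff.2 fun j => ?_
    refine ((hW j).ae_iff (p := fun y => y = 0 ∨ y = 1) (measurable_of_countable _)).2 ?_
    rw [ae_iff, bernoulliMeasure_apply_of_notMem_of_notMem _ (MeasurableSet.of_discrete)] <;> simp
  have hle' : ∀ᵐ ω ∂P, ∀ m, ∑ j ∈ Finset.range m, Y j ω ≤ ∑ j ∈ Finset.range m, Z j ω := by
    refine ae_all_iff.2 fun m => ?_
    have hnull : NullMeasurableSet
        {ω | ∑ j ∈ Finset.range m, Y j ω ≤ ∑ j ∈ Finset.range m, Z j ω} P :=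
      nullMeasurableSet_le (Finset.aemeasurable_fun_sum _ fun j _ => (hY j).aemeasurable)
        (Finset.aemeasurable_fun_sum _ fun j _ => (hZ j).aemeasurable)
    exact (prob_compl_eq_zero_iff₀ hnull).2 (hle m)
  have hmeas : MeasurableSet {s : (ℕ → ℤˣ) × (ℕ → ℤˣ) | ∀ k : ℕ,
      ∑ j ∈ Finset.range k, (s.1 j : ℤ) ≤ ∑ j ∈ Finset.range k, (s.2 j : ℤ)} := by
    have hv : Measurable fun e : ℤˣ => (e : ℤ) := measurable_of_countable _
    refine MeasurableSet.iInter (ι := ℕ) (f := fun k => {s : (ℕ → ℤˣ) × (ℕ → ℤˣ) |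
      ∑ j ∈ Finset.range k, (s.1 j : ℤ) ≤ ∑ j ∈ Finset.range k, (s.2 j : ℤ)}) (fun k => ?_) |>.congr ?_
    · exact measurableSet_le
        (Finset.measurable_fun_sum _ fun j _ => hv.comp ((measurable_pi_apply j).comp measurable_fst))
        (Finset.measurable_fun_sum _ fun j _ => hv.comp ((measurable_pi_apply j).comp measurable_snd))
    · ext s; simp
  rw [ae_map_iff hpair hmeas]
  filter_upwards [h01 p Y hY, h01 q Z hZ, hle'] with ω h1 h2 h3 k
  -- The arrow is an increasing affine function of the Bernoulli value, so the order of partial sums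
  -- carries over.
  have harr : ∀ y : ℕ, y = 0 ∨ y = 1 → ((arrowOfNat y : ℤˣ) : ℤ) = 2 * y - 1 := by
    rintro y (rfl | rfl) <;> simp [arrowOfNat]
  simp only [harr _ (h1 _), harr _ (h2 _), Finset.sum_sub_distrib, ← Finset.mul_sum]
  have := h3 k
  zify at this
  linarith

section Stacks

variable {S : Type} [MeasurableSpace S] {μ : Measure S} [IsProbabilityMeasure μ]
  {π : S → ℕ → ℤˣ} {r : CookieEnv}

lemma hasLaw_stack (hπ : Measurable π)
    (hlaw : μ.map π = Measure.infinitePi fun k => bernoulliMeasure 1 (-1) (r.prob k)) (x : ℤ) :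
    HasLaw (fun ω : ℤ → S => π (ω x))
      (Measure.infinitePi fun k => bernoulliMeasure 1 (-1) (r.prob k))
      (Measure.infinitePi fun _ : ℤ => μ) := by
  refine HasLaw.comp (Y := π) ⟨hπ.aemeasurable, hlaw⟩ (X := fun ω : ℤ → S => ω x)
    ⟨(measurable_pi_apply x).aemeasurable, Measure.infinitePi_map_eval _ x⟩

lemma hasLaw_arrow (hπ : Measurable π)
    (hlaw : μ.map π = Measure.infinitePi fun k => bernoulliMeasure 1 (-1) (r.prob k))
    (x : ℤ) (k : ℕ) :
    HasLaw (fun ω : ℤ → S => π (ω x) k) (bernoulliMeasure 1 (-1) (r.prob k))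
      (Measure.infinitePi fun _ : ℤ => μ) :=
  HasLaw.comp (Y := fun s : ℕ → ℤˣ => s k)
    ⟨(measurable_pi_apply k).aemeasurable, Measure.infinitePi_map_eval _ k⟩
    (hasLaw_stack hπ hlaw x)

lemma iIndepFun_stack (hπ : Measurable π)
    (hlaw : μ.map π = Measure.infinitePi fun k => bernoulliMeasure 1 (-1) (r.prob k)) (x : ℤ) :
    iIndepFun (fun (k : ℕ) (ω : ℤ → S) => π (ω x) k) (Measure.infinitePi fun _ : ℤ => μ) :=
  (iIndepFun_iff_hasLaw_Pi_infinitePi (fun k => hasLaw_arrow hπ hlaw x k)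
    (hasLaw_stack hπ hlaw x).aemeasurable).2 (hasLaw_stack hπ hlaw x)

lemma iIndepFun_arrows (hπ : Measurable π)
    (hlaw : μ.map π = Measure.infinitePi fun k => bernoulliMeasure 1 (-1) (r.prob k)) :
    iIndepFun (fun (i : ℤ × ℕ) (ω : ℤ → S) => π (ω i.1) i.2)
      (Measure.infinitePi fun _ : ℤ => μ) :=
  iIndepFun_uncurry' (X := fun (x : ℤ) (k : ℕ) (ω : ℤ → S) => π (ω x) k)
    (fun x k => (measurable_pi_apply k).comp (hπ.comp (measurable_pi_apply x)))
    (iIndepFun_infinitePi (P := fun _ : ℤ => μ) (X := fun _ => π) fun _ => hπ)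
    (iIndepFun_stack hπ hlaw)

lemma measurable_stacks (hπ : Measurable π) :
    Measurable fun (ω : ℤ → S) => ((fun x => π (ω x)) : ArrowSystem) :=
  measurable_pi_lambda _ fun x => hπ.comp (measurable_pi_apply x)

end Stacks

lemma isArrowCoupling_infinitePi {p q : CookieEnv} {μ : Measure ((ℕ → ℤˣ) × (ℕ → ℤˣ))}
    [IsProbabilityMeasure μ]
    (hp : μ.map Prod.fst = Measure.infinitePi (fun k => bernoulliMeasure 1 (-1) (p.prob k)))
    (hq : μ.map Prod.snd = Measure.infinitePi (fun k => bernoulliMeasure 1 (-1) (q.prob k)))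
    (hle : ∀ᵐ s ∂μ, ∀ k : ℕ,
      ∑ j ∈ Finset.range k, (s.1 j : ℤ) ≤ ∑ j ∈ Finset.range k, (s.2 j : ℤ)) :
    IsArrowCoupling (Measure.infinitePi fun _ : ℤ => μ) p q
      (fun ω x => (ω x).1) (fun ω x => (ω x).2) where
  measurable_left := measurable_stacks measurable_fst
  measurable_right := measurable_stacks measurable_snd
  indep_sites := iIndepFun_infinitePi (P := fun _ : ℤ => μ) (X := fun _ s => s)
    fun _ => measurable_id
  ident_sites := fun x =>
    ⟨(measurable_pi_apply x).aemeasurable, (measurable_pi_apply 0).aemeasurable,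
      (Measure.infinitePi_map_eval (fun _ : ℤ => μ) x).trans
        (Measure.infinitePi_map_eval (fun _ : ℤ => μ) 0).symm⟩
  indep_left := iIndepFun_stack measurable_fst hp
  indep_right := iIndepFun_stack measurable_snd hq
  law_left := hasLaw_arrow measurable_fst hp
  law_right := hasLaw_arrow measurable_snd hq
  le := ae_all_iff.2 fun x =>
    (measurePreserving_eval_infinitePi (fun _ : ℤ => μ) x).quasiMeasurePreserving.ae hle
  walk_left := hasLaw_walk (measurable_stacks measurable_fst) (iIndepFun_arrows measurable_fst hp)
    (hasLaw_arrow measurable_fst hp)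
  walk_right := hasLaw_walk (measurable_stacks measurable_snd) (iIndepFun_arrows measurable_snd hq)
    (hasLaw_arrow measurable_snd hq)

/-! ### Measurability of the regeneration functionals -/

lemma measurable_hitTime (S : Set ℤ) :
    Measurable fun X : ℕ → ℤ => (hitTime X S : ℝ≥0∞) := by
  classical
  have : ∀ X : ℕ → ℤ, (hitTime X S : ℝ≥0∞) = ⨅ n : ℕ, if X n ∈ S then (n : ℝ≥0∞) else ⊤ := by
    intro X
    simp only [hitTime, ENat.toENNReal_iInf]
    refine iInf_congr fun n => ?_
    split_ifs with h <;> simp [h]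
  simp only [this]
  exact Measurable.iInf fun n => Measurable.ite
    (measurable_pi_apply n (MeasurableSet.of_discrete)) measurable_const measurable_const

namespace ArrowSystem

lemma measurable_shift (x : ℤ) : Measurable fun E : ArrowSystem => E.shift x :=
  measurable_pi_lambda _ fun y => measurable_pi_apply (x + y)

lemma measurable_gap : Measurable gap := by
  have hst : ∀ y : ℕ, MeasurableSet {L : ArrowSystem | 0 < y ∧ (L.shift y).Stays} := fun y =>
    (MeasurableSet.const _).inter (measurable_shift y measurableSet_stays)
  refine measurable_of_Iic fun n => ?_
  -- The last set accounts for the default value: without any positive regeneration level, `gap` is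
  -- `sInf ∅ = 0`.
  have : gap ⁻¹' Set.Iic n = (⋃ y ∈ Finset.range (n + 1), {L : ArrowSystem |
      0 < y ∧ (L.shift y).Stays}) ∪ (⋃ y : ℕ, {L : ArrowSystem | 0 < y ∧ (L.shift y).Stays})ᶜ := by
    ext L
    simp only [Set.mem_preimage, Set.mem_Iic, Set.mem_union, Set.mem_iUnion, Finset.mem_range,
      Set.mem_compl_iff, exists_prop]
    constructor
    · intro h
      by_cases hne : ∃ y : ℕ, 0 < y ∧ (L.shift y).Stays
      · exact Or.inl ⟨L.gap, by omega,
          Nat.sInf_mem (s := {y : ℕ | 0 < y ∧ (L.shift y).Stays}) hne⟩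
      · exact Or.inr hne
    · rintro (⟨y, hy, hy'⟩ | h)
      · exact (Nat.sInf_le (s := {y : ℕ | 0 < y ∧ (L.shift y).Stays}) hy').trans (by omega)
      · have : {y : ℕ | 0 < y ∧ (L.shift y).Stays} = ∅ :=
          Set.eq_empty_iff_forall_notMem.2 fun y hy => h ⟨y, hy⟩
        simp [gap, this]
  rw [this]
  exact (Finset.measurableSet_biUnion _ fun y _ => hst y).union (MeasurableSet.iUnion hst).compl

lemma measurable_cost : Measurable fun r : ArrowSystem × ArrowSystem => r.1.cost r.2 := by
  classical
  refine Measurable.ite (measurable_fst measurableSet_stays) ?_ measurable_const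
  exact measurable_eval_countable
    (f := fun (y : ℕ) (r : ArrowSystem × ArrowSystem) => (hitTime r.2.walk {(y : ℤ)} : ℝ≥0∞))
    (fun y => (measurable_hitTime _).comp (measurable_walk.comp measurable_snd))
    (measurable_gap.comp measurable_fst)

lemma measurable_gapOn : Measurable gapOn := by
  classical
  exact Measurable.ite measurableSet_stays
    ((measurable_of_countable fun n : ℕ => (n : ℝ≥0∞)).comp measurable_gap) measurable_const

end ArrowSystem

end ExcitedRW

/-! ### Densities and speeds -/

section Density

open Classical in
lemma exists_ge_of_density {s : ℕ → Prop} {a : ℝ≥0∞} (ha : a ≠ 0)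
    (h : Tendsto (fun N : ℕ => (∑ x ∈ Finset.range N, if s x then (1 : ℝ≥0∞) else 0) / N) atTop (𝓝 a))
    (N : ℕ) : ∃ y, N ≤ y ∧ s y := by
  by_contra! hcon
  refine ha (tendsto_nhds_unique h ?_)
  have hb : ∀ M : ℕ, (∑ x ∈ Finset.range M, if s x then (1 : ℝ≥0∞) else 0) ≤ N := by
    intro M
    calc (∑ x ∈ Finset.range M, if s x then (1 : ℝ≥0∞) else 0)
        ≤ ∑ x ∈ Finset.range (max M N), if s x then (1 : ℝ≥0∞) else 0 :=
          Finset.sum_le_sum_of_subset (Finset.range_mono (le_max_left _ _))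
      _ = ∑ x ∈ Finset.range N, if s x then (1 : ℝ≥0∞) else 0 := by
          refine (Finset.sum_subset (Finset.range_mono (le_max_right _ _)) fun x _ hx => ?_).symm
          rw [if_neg (hcon x (by simpa using hx))]
      _ ≤ ∑ x ∈ Finset.range N, 1 := Finset.sum_le_sum fun x _ => by split_ifs <;> simp
      _ = N := by simp
  have hz : Tendsto (fun M : ℕ => (N : ℝ≥0∞) / M) atTop (𝓝 0) := by
    have := ENNReal.Tendsto.const_div (a := (N : ℝ≥0∞)) ENNReal.tendsto_nat_nhds_top
      (Or.inr (ENNReal.natCast_ne_top N))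
    simpa using this
  exact tendsto_of_tendsto_of_tendsto_of_le_of_le tendsto_const_nhds hz (fun _ => zero_le)
    fun M => ENNReal.div_le_div_right (hb M) _

-- No point of `s` lies in `[N, next N)`, so the counts up to `N` and up to `next N` coincide;
-- dividing the two density limits, both equal to `a`, leaves the ratio `next N / N`.
open Classical in
lemma tendsto_next_div {s : ℕ → Prop} {a : ℝ≥0∞} (ha : a ≠ 0) (ha' : a ≠ ∞)
    (h : Tendsto (fun N : ℕ => (∑ x ∈ Finset.range N, if s x then (1 : ℝ≥0∞) else 0) / N) atTop (𝓝 a))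
    {next : ℕ → ℕ} (hle : ∀ N, N ≤ next N) (hgap : ∀ N y, N ≤ y → s y → next N ≤ y) :
    Tendsto (fun N : ℕ => (next N : ℝ) / N) atTop (𝓝 1) := by
  have hc : ∀ N : ℕ, (∑ x ∈ Finset.range N, if s x then (1 : ℝ≥0∞) else 0) = (Nat.count s N : ℝ≥0∞) := by
    intro N
    rw [Nat.count_eq_card_filter_range, Finset.sum_ite]
    simp
  have hcount : ∀ N, Nat.count s (next N) = Nat.count s N := by
    intro N
    rw [Nat.count_eq_card_filter_range, Nat.count_eq_card_filter_range]
    congr 1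
    ext x
    simp only [Finset.mem_filter, Finset.mem_range, and_congr_left_iff]
    intro hx
    refine ⟨fun hlt => ?_, fun hlt => hlt.trans_le (hle N)⟩
    by_contra hge
    exact absurd (hgap N x (not_lt.1 hge) hx) (not_le.2 hlt)
  have hr : Tendsto (fun N : ℕ => (Nat.count s N : ℝ) / N) atTop (𝓝 a.toReal) := by
    have := (ENNReal.tendsto_toReal ha').comp h
    refine this.congr fun N => ?_
    simp [hc]
  have ha0 : a.toReal ≠ 0 := ENNReal.toReal_ne_zero.2 ⟨ha, ha'⟩
  have hnext : Tendsto next atTop atTop := tendsto_atTop_mono hle tendsto_id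
  have hdiv := hr.div (hr.comp hnext) ha0
  rw [div_self ha0] at hdiv
  refine hdiv.congr' ?_
  filter_upwards [hr.eventually_ne ha0] with N hN
  have h1 : (Nat.count s N : ℝ) ≠ 0 := fun h0 => hN (by simp [h0])
  simp only [Pi.div_apply, Function.comp_apply, hcount]
  rw [div_div_div_cancel_left' _ _ h1]

lemma tendsto_const_add_div {S : ℕ → ℝ≥0∞} {D c : ℝ≥0∞} (hc : c ≠ ∞)
    (h : Tendsto (fun N : ℕ => S N / N) atTop (𝓝 D)) :
    Tendsto (fun N : ℕ => (c + S N) / N) atTop (𝓝 D) := by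
  have hz : Tendsto (fun M : ℕ => c / M) atTop (𝓝 0) := by
    simpa using ENNReal.Tendsto.const_div (a := c) ENNReal.tendsto_nat_nhds_top (Or.inr hc)
  simpa [ENNReal.add_div] using hz.add h

/-- If the path `X` crosses the levels `s N ~ N` for good at the times `T N ~ D N`, its speed is
`1 / D`. -/
lemma tendsto_path_div {X : ℕ → ℤ} {s T : ℕ → ℕ} {D : ℝ≥0∞} (hD : D ≠ 0)
    (hs : ∀ N, N ≤ s N) (hsT : ∀ N, s N ≤ T N)
    (hlow : ∀ N n, T N ≤ n → (s N : ℤ) ≤ X n) (hup : ∀ N n, n < T N → X n < s N)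
    (hs1 : Tendsto (fun N : ℕ => (s N : ℝ) / N) atTop (𝓝 1))
    (hTD : Tendsto (fun N : ℕ => (T N : ℝ≥0∞) / N) atTop (𝓝 D)) :
    Tendsto (fun n : ℕ => (X n : ℝ) / n) atTop (𝓝 (D⁻¹).toReal) := by
  have hv : Tendsto (fun N : ℕ => (N : ℝ) / T N) atTop (𝓝 (D⁻¹).toReal) := by
    have := (ENNReal.tendsto_toReal (ENNReal.inv_ne_top.2 hD)).comp (tendsto_inv_iff.2 hTD)
    refine this.congr fun N => ?_
    simp
  have hn1 : Tendsto (fun N : ℕ => (N : ℝ) / ((N : ℝ) + 1)) atTop (𝓝 1) :=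
    tendsto_natCast_div_add_atTop 1
  have hlo : Tendsto (fun N : ℕ => (N : ℝ) / T (N + 1)) atTop (𝓝 (D⁻¹).toReal) := by
    have := hn1.mul ((tendsto_add_atTop_iff_nat 1).2 hv)
    rw [one_mul] at this
    refine this.congr fun N => ?_
    have : (N : ℝ) + 1 ≠ 0 := by positivity
    push_cast
    field_simp
  have hhi : Tendsto (fun N : ℕ => (s (N + 1) : ℝ) / T N) atTop (𝓝 (D⁻¹).toReal) := by
    have := (((tendsto_add_atTop_iff_nat 1).2 hs1).mul (hn1.inv₀ one_ne_zero)).mul hv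
    rw [inv_one, one_mul, one_mul] at this
    refine this.congr' ?_
    filter_upwards [eventually_gt_atTop 0] with N hN
    have h1 : (N : ℝ) + 1 ≠ 0 := by positivity
    have h2 : (N : ℝ) ≠ 0 := by positivity
    have h3 : (T N : ℝ) ≠ 0 := by
      have := (hs N).trans (hsT N)
      have : 0 < T N := by omega
      positivity
    push_cast
    field_simp
  classical
  -- The last index whose crossing time is at most `n`; searching up to `n` suffices since `N ≤ s N
  -- ≤ T N`. Then `X n / n` lies between `K n / T (K n + 1)` and `s (K n + 1) / T (K n)`.
  let K : ℕ → ℕ := fun n => Nat.findGreatest (fun N => T N ≤ n) n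
  have hK : Tendsto K atTop atTop := by
    refine tendsto_atTop.2 fun b => ?_
    filter_upwards [eventually_ge_atTop (max b (T b))] with n hn
    exact Nat.le_findGreatest ((le_max_left _ _).trans hn) ((le_max_right _ _).trans hn)
  have hK1 : ∀ n, n < T (K n + 1) := by
    intro n
    by_cases h : K n + 1 ≤ n
    · exact not_le.1 (Nat.findGreatest_is_greatest (P := fun N => T N ≤ n) (Nat.lt_succ_self _) h)
    · have := (hs (K n + 1)).trans (hsT (K n + 1))
      omega
  have hK2 : ∀ᶠ n in atTop, T (K n) ≤ n := by
    filter_upwards [eventually_ge_atTop (T 0)] with n hn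
    exact Nat.findGreatest_spec (P := fun N => T N ≤ n) (Nat.zero_le n) hn
  refine tendsto_of_tendsto_of_tendsto_of_le_of_le' (hlo.comp hK) (hhi.comp hK) ?_ ?_
  · filter_upwards [hK2, eventually_gt_atTop 0] with n hn hn0
    have h1 : (K n : ℝ) ≤ X n := by
      have := hlow _ _ hn
      have := hs (K n)
      exact_mod_cast (by omega : (K n : ℤ) ≤ X n)
    have h2 : (n : ℝ) ≤ T (K n + 1) := by exact_mod_cast (hK1 n).le
    have h3 : (0 : ℝ) < n := by exact_mod_cast hn0
    have h4 : (0 : ℝ) ≤ X n := (Nat.cast_nonneg _).trans h1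
    simp only [Function.comp_apply]
    gcongr
  · filter_upwards [hK2, hK.eventually_gt_atTop 0] with n hn hn0
    have h1 : (X n : ℝ) ≤ s (K n + 1) := by exact_mod_cast (hup _ _ (hK1 n)).le
    have h2 : (T (K n) : ℝ) ≤ n := by exact_mod_cast hn
    have h3 : (0 : ℝ) < T (K n) := by
      have := (hs (K n)).trans (hsT (K n))
      exact_mod_cast (by omega : 0 < T (K n))
    simp only [Function.comp_apply]
    gcongr

end Density

namespace ExcitedRW

open ArrowSystem

open Classical in
/-- The deterministic part of the renewal argument: the speed of the walk of `E`, in terms of the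
averages of `cost` along the regeneration levels of the walk of `L`. -/
lemma tendsto_walk_div {L E : ArrowSystem} {a D : ℝ≥0∞} (ha : a ≠ 0) (ha' : a ≠ ∞) (hD : D ≠ 0)
    (hdens : Tendsto (fun N : ℕ => (∑ x ∈ Finset.range N,
      if (L.shift x).Stays then (1 : ℝ≥0∞) else 0) / N) atTop (𝓝 a))
    (hcost : Tendsto (fun N : ℕ => (∑ x ∈ Finset.range N,
      (L.shift x).cost (E.shift x)) / N) atTop (𝓝 D))
    (hit : ∀ x : ℕ, ∃ n, E.walk n = x) (hE : ∀ x : ℕ, (L.shift x).Stays → (E.shift x).Stays) :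
    Tendsto (fun n : ℕ => (E.walk n : ℝ) / n) atTop (𝓝 (D⁻¹).toReal) := by
  have hinf := exists_ge_of_density (s := fun x : ℕ => (L.shift x).Stays) ha hdens
  have hspec := nextLevel_spec hinf
  have hT : ∀ N, ∃ n : ℕ, hitTime E.walk {(L.nextLevel N : ℤ)} = n ∧
      E.walk n = L.nextLevel N ∧ ∀ m < n, E.walk m ≠ L.nextLevel N := fun N => by
    simpa using exists_hitTime_eq (X := E.walk) (S := {(L.nextLevel N : ℤ)}) (hit _)
  choose T hT1 hT2 hT3 using hT
  have hT3' := fun N => lt_of_first_hit (by omega) (hT3 N)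
  refine tendsto_path_div (s := L.nextLevel) (T := T) hD (fun N => (hspec N).1) (fun N => ?_)
    (fun N n hn => ?_) hT3' (tendsto_next_div ha ha' hdens (fun N => (hspec N).1)
      fun N y => nextLevel_le) ?_
  · have := (abs_le.1 (E.abs_walk_le (T N))).2
    rw [hT2] at this
    exact_mod_cast this
  · obtain ⟨m, rfl⟩ := Nat.exists_eq_add_of_le hn
    rw [(hE _ (hspec N).2).walk_add (hT2 N) (hT3' N)]
    have := (hE _ (hspec N).2).nonneg m
    omega
  · have hsum := hitTime_nextLevel hinf hit hE
    simp only [hT1, ENat.toENNReal_coe] at hsum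
    exact (tendsto_const_add_div (ENNReal.natCast_ne_top (T 0)) hcost).congr fun N => by
      rw [hsum N]

-- The partial sums of the gaps equal `nextLevel N` up to a constant, and positive density forces
-- `nextLevel N` to be asymptotic to `N`.
open Classical in
lemma gapOn_average_eq_one {L : ArrowSystem} {a D : ℝ≥0∞} (ha : a ≠ 0) (ha' : a ≠ ∞)
    (hdens : Tendsto (fun N : ℕ => (∑ x ∈ Finset.range N,
      if (L.shift x).Stays then (1 : ℝ≥0∞) else 0) / N) atTop (𝓝 a))
    (hgap : Tendsto (fun N : ℕ => (∑ x ∈ Finset.range N, (L.shift x).gapOn) / N) atTop (𝓝 D)) :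
    D = 1 := by
  have hinf := exists_ge_of_density (s := fun x : ℕ => (L.shift x).Stays) ha hdens
  have h1 := tendsto_next_div ha ha' hdens (fun N => (nextLevel_spec hinf N).1)
    fun N y => nextLevel_le
  have h2 : Tendsto (fun N : ℕ => (L.nextLevel N : ℝ≥0∞) / N) atTop (𝓝 D) := by
    exact (tendsto_const_add_div (ENNReal.natCast_ne_top (L.nextLevel 0)) hgap).congr fun N => by
      rw [nextLevel_eq_sum hinf N]
  have h3 := ENNReal.tendsto_ofReal h1
  rw [ENNReal.ofReal_one] at h3
  refine tendsto_nhds_unique h2 (h3.congr' ?_)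
  filter_upwards [eventually_gt_atTop 0] with N hN
  rw [ENNReal.ofReal_div_of_pos (by exact_mod_cast hN), ENNReal.ofReal_natCast,
    ENNReal.ofReal_natCast]

end ExcitedRW

/-! ### The theorem -/

namespace ExcitedRW

open ArrowSystem

section Ergodic

variable {S : Type} [MeasurableSpace S] {μ : Measure S} [IsProbabilityMeasure μ]

/-- The restriction of a two-sided sequence to the non-negative sites. -/
def rightHalf (ω : ℤ → S) : ℕ → S := fun i => ω i

variable (μ) in
lemma measurePreserving_rightHalf :
    MeasurePreserving (rightHalf : (ℤ → S) → ℕ → S) (Measure.infinitePi fun _ : ℤ => μ)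
      (Measure.infinitePi fun _ : ℕ => μ) where
  measurable := measurable_pi_lambda _ fun i => measurable_pi_apply (i : ℤ)
  map_eq := Measure.map_infinitePi_infinitePi_of_inj (P := fun _ : ℤ => μ)
    (f := fun i : ℕ => (i : ℤ)) Nat.cast_injective

/-- The pointwise ergodic theorem for a functional of two families of stacks that depends only on
the sites that are not to the left of `0`. -/
lemma ae_tendsto_average {F : ArrowSystem × ArrowSystem → ℝ≥0∞} (hF : Measurable F)
    {π₁ π₂ : S → ℕ → ℤˣ} (h₁ : Measurable π₁) (h₂ : Measurable π₂)
    {G : ArrowSystem → ArrowSystem → Prop}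
    (hG : ∀ᵐ ω ∂(Measure.infinitePi fun _ : ℤ => μ), ∀ x : ℕ,
      G (shift (fun y => π₁ (ω y)) x) (shift (fun y => π₂ (ω y)) x))
    (hloc : ∀ L E L' E' : ArrowSystem, G L E → (∀ y, 0 ≤ y → L' y = L y) →
      (∀ y, 0 ≤ y → E' y = E y) → F (L', E') = F (L, E)) :
    ∀ᵐ ω ∂(Measure.infinitePi fun _ : ℤ => μ), Tendsto (fun N : ℕ =>
      (∑ x ∈ Finset.range N, F (shift (fun y => π₁ (ω y)) x, shift (fun y => π₂ (ω y)) x)) / N)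
      atTop (𝓝 (∫⁻ ω, F (fun y => π₁ (ω y), fun y => π₂ (ω y))
        ∂(Measure.infinitePi fun _ : ℤ => μ))) := by
  -- Negative sites are filled with copies of the stack at `0`; by `hloc` this filling does not
  -- affect the value of `F`.
  let f : (ℕ → S) → ℝ≥0∞ := fun η => F (fun y => π₁ (η y.toNat), fun y => π₂ (η y.toNat))
  have hf : Measurable f := hF.comp
    ((measurable_pi_lambda _ fun y => h₁.comp (measurable_pi_apply _)).prodMk
      (measurable_pi_lambda _ fun y => h₂.comp (measurable_pi_apply _)))
  have hmp := measurePreserving_rightHalf μ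
  have hfx : ∀ᵐ ω ∂(Measure.infinitePi fun _ : ℤ => μ), ∀ x : ℕ,
      f ((fun (η : ℕ → S) i => η (i + 1))^[x] (rightHalf ω)) =
        F (shift (fun y => π₁ (ω y)) x, shift (fun y => π₂ (ω y)) x) := by
    filter_upwards [hG] with ω hω x
    refine hloc _ _ _ _ (hω x) (fun y hy => ?_) fun y hy => ?_ <;>
    · simp only [iterate_shift, rightHalf, shift]
      congr 2
      push_cast
      rw [Int.toNat_of_nonneg hy]
  have hint : ∫⁻ η, f η ∂(Measure.infinitePi fun _ : ℕ => μ) =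
      ∫⁻ ω, F (fun y => π₁ (ω y), fun y => π₂ (ω y)) ∂(Measure.infinitePi fun _ : ℤ => μ) := by
    rw [← hmp.map_eq, lintegral_map hf hmp.measurable]
    refine lintegral_congr_ae ?_
    filter_upwards [hfx] with ω hω
    simpa using hω 0
  have hlim := hmp.quasiMeasurePreserving.ae
    (ae_tendsto_birkhoffSum_div_lintegral (ergodic_shift μ) hf)
  rw [hint] at hlim
  filter_upwards [hlim, hfx] with ω h1 h2
  refine h1.congr fun N => ?_
  simp only [birkhoffSum, h2]

end Ergodic

lemma coe_toReal_inv_eq {D : ℝ≥0∞} (hD : D ≠ 0) :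
    (((D⁻¹).toReal : ℝ) : EReal) = ((1 : ℝ) : EReal) / (D : EReal) := by
  induction D with
  | top => simp
  | coe r =>
    have hr : r ≠ 0 := by simpa using hD
    rw [ENNReal.toReal_inv, ENNReal.coe_toReal, show ((r : ℝ≥0∞) : EReal) = ((r : ℝ) : EReal) from rfl,
      ← EReal.coe_div, one_div]

lemma isSpeed_of_ae {Ω : Type*} [MeasurableSpace Ω] {P : Measure Ω} {p : CookieEnv}
    {E : Ω → ArrowSystem} (hE : HasLaw (fun ω => (E ω).walk) (erwLaw p) P) {v : ℝ}
    (h : ∀ᵐ ω ∂P, Tendsto (fun n : ℕ => ((E ω).walk n : ℝ) / n) atTop (𝓝 v)) : IsSpeed p v := by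
  refine (hE.ae_iff (p := fun X => Tendsto (fun n : ℕ => (X n : ℝ) / n) atTop (𝓝 v)) ?_).1 h
  refine measurableSet_setOfPred.1 (measurableSet_tendsto (𝓝 v)
    (f := fun (n : ℕ) (X : ℕ → ℤ) => (X n : ℝ) / n) fun n => ?_)
  exact ((measurable_of_countable fun z : ℤ => (z : ℝ)).comp (measurable_pi_apply n)).div_const _

end ExcitedRW

open ExcitedRW ExcitedRW.ArrowSystem in
theorem mainTheorem2 (p q : ExcitedRW.CookieEnv)
    (htrans : ExcitedRW.TransientRight p) (hpq : ExcitedRW.Precedes p q) :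
    ∃ (Ω : Type) (_ : MeasurableSpace Ω) (P : Measure Ω) (_ : IsProbabilityMeasure P)
      (L R : Ω → ExcitedRW.ArrowSystem),
      ExcitedRW.IsArrowCoupling P p q L R ∧
      (∀ᵐ ω ∂P, ExcitedRW.regenLevels (L ω).walk ⊆ ExcitedRW.regenLevels (R ω).walk) ∧
      (∀ᵐ ω ∂P, ExcitedRW.regenTime (L ω).walk ≠ ⊤ ∧
        ExcitedRW.hitTime (R ω).walk {ExcitedRW.regenPos (L ω).walk} ≠ ⊤) ∧
      ∃ (num : ℝ) (denp denq : ℝ≥0∞) (vp vq : ℝ),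
        Integrable ({ω | (0 : ℤ) ∈ ExcitedRW.regenLevels (L ω).walk}.indicator
          fun ω => (ExcitedRW.regenPos (L ω).walk : ℝ)) P ∧
        num = ∫ ω, {ω | (0 : ℤ) ∈ ExcitedRW.regenLevels (L ω).walk}.indicator
          (fun ω => (ExcitedRW.regenPos (L ω).walk : ℝ)) ω ∂P ∧
        denp = ∫⁻ ω, {ω | (0 : ℤ) ∈ ExcitedRW.regenLevels (L ω).walk}.indicator
          (fun ω => (ExcitedRW.regenTime (L ω).walk : ℝ≥0∞)) ω ∂P ∧
        denq = ∫⁻ ω, {ω | (0 : ℤ) ∈ ExcitedRW.regenLevels (L ω).walk}.indicator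
          (fun ω => (ExcitedRW.hitTime (R ω).walk {ExcitedRW.regenPos (L ω).walk} : ℝ≥0∞)) ω ∂P ∧
        denp ≠ 0 ∧ denq ≠ 0 ∧
        ExcitedRW.IsSpeed p vp ∧ ExcitedRW.IsSpeed q vq ∧
        (vp : EReal) = (num : EReal) / (denp : EReal) ∧
        (vq : EReal) = (num : EReal) / (denq : EReal) := by
  classical
  obtain ⟨μ, hμ, hp, hq, hle⟩ := exists_stack_coupling hpq
  set P : Measure (ℤ → (ℕ → ℤˣ) × (ℕ → ℤˣ)) := Measure.infinitePi fun _ : ℤ => μ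
  let L : (ℤ → (ℕ → ℤˣ) × (ℕ → ℤˣ)) → ArrowSystem := fun ω x => (ω x).1
  let R : (ℤ → (ℕ → ℤˣ) × (ℕ → ℤˣ)) → ArrowSystem := fun ω x => (ω x).2
  have hcoup : IsArrowCoupling P p q L R := isArrowCoupling_infinitePi hp hq hle
  have hLm : Measurable L := hcoup.measurable_left
  have hSt : MeasurableSet {ω | (L ω).Stays} := hLm measurableSet_stays
  have htr : ∀ᵐ ω ∂P, Tendsto (L ω).walk atTop atTop :=
    ae_of_ae_map hcoup.walk_left.aemeasurable 
      (by rw [hcoup.walk_left.map_eq]; exact htrans)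
  have hpos : P {ω | (L ω).Stays} ≠ 0 := measure_stays_ne_zero hLm
    (iIndepFun_arrows measurable_fst hp) hcoup.law_left htr
  have hLhit : ∀ᵐ ω ∂P, ∀ x : ℕ, ∃ n, (L ω).walk n = x := by
    filter_upwards [htr] with ω hω x
    obtain ⟨n, hn⟩ := (hω.eventually_ge_atTop (x : ℤ)).exists
    obtain ⟨m, -, hm⟩ := exists_walk_eq (Nat.cast_nonneg x) hn
    exact ⟨m, hm⟩
  have hRhit : ∀ᵐ ω ∂P, ∀ x : ℕ, ∃ n, (R ω).walk n = x := by
    filter_upwards [hLhit, hcoup.le] with ω h1 h2 x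
    obtain ⟨n, hn⟩ := h1 x
    exact h2.exists_walk_eq (Nat.cast_nonneg x) hn
  have hstays : ∀ᵐ ω ∂P, ∀ x : ℕ, ((L ω).shift x).Stays → ((R ω).shift x).Stays := by
    filter_upwards [hcoup.le] with ω hω x hx
    exact (hω.shift x).stays hx
  have hdens : ∀ᵐ ω ∂P, Tendsto (fun N : ℕ => (∑ x ∈ Finset.range N,
      if ((L ω).shift x).Stays then (1 : ℝ≥0∞) else 0) / N) atTop (𝓝 (P {ω | (L ω).Stays})) := by
    have h := ae_tendsto_average (μ := μ) (F := fun r => if r.1.Stays then 1 else 0)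
      (Measurable.ite (measurable_fst measurableSet_stays) measurable_const measurable_const)
      measurable_fst measurable_snd (G := fun _ _ => True) (by simp)
      fun L E L' E' _ h _ => by simp only [stays_congr h]
    have hint : ∫⁻ ω, (if (L ω).Stays then (1 : ℝ≥0∞) else 0) ∂P = P {ω | (L ω).Stays} := by
      rw [← lintegral_indicator_one hSt]
      rfl
    rw [← hint]
    exact h
  have hcostL := ae_tendsto_average (μ := μ) (F := fun r => r.1.cost r.1)
    (measurable_cost.comp (measurable_fst.prodMk measurable_fst)) measurable_fst measurable_snd
    (G := fun _ _ => True) (by simp) fun L E L' E' _ h _ => cost_congr h h id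
  have hcostR := ae_tendsto_average (μ := μ) (F := fun r => r.1.cost r.2)
    measurable_cost measurable_fst measurable_snd
    (G := fun L E => L.Stays → E.Stays) hstays fun L E L' E' h h1 h2 => cost_congr h1 h2 h
  have hgapL := ae_tendsto_average (μ := μ) (F := fun r => r.1.gapOn)
    (measurable_gapOn.comp measurable_fst) measurable_fst measurable_snd
    (G := fun _ _ => True) (by simp) fun L E L' E' _ h _ => gapOn_congr h
  set DL : ℝ≥0∞ := ∫⁻ ω, (L ω).cost (L ω) ∂P
  set DR : ℝ≥0∞ := ∫⁻ ω, (L ω).cost (R ω) ∂P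
  have hinf : ∀ᵐ ω ∂P, ∀ N : ℕ, ∃ y : ℕ, N ≤ y ∧ ((L ω).shift y).Stays := by
    filter_upwards [hdens] with ω hω
    exact exists_ge_of_density (s := fun x : ℕ => ((L ω).shift x).Stays) hpos hω
  have hgap1 : ∫⁻ ω, (L ω).gapOn ∂P = 1 := by
    -- The mean gap is a deterministic limit, so a single typical sample identifies it.
    obtain ⟨ω, h1, h2⟩ := (hdens.and hgapL).exists
    exact gapOn_average_eq_one hpos (measure_ne_top _ _) h1 h2
  -- When `0` regenerates the cost is at least `1`, since every walk starts at `0` and the gap is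
  -- positive; so the mean cost is at least the probability of that event.
  have hcost_ge : ∀ E : (ℤ → (ℕ → ℤˣ) × (ℕ → ℤˣ)) → ArrowSystem,
      ∫⁻ ω, (L ω).cost (E ω) ∂P ≠ 0 := by
    intro E h0
    have hle : P {ω | (L ω).Stays} ≤ ∫⁻ ω, (L ω).cost (E ω) ∂P := by
      rw [← lintegral_indicator_one hSt]
      refine lintegral_mono_ae ?_
      filter_upwards [hinf] with ω hω
      by_cases h : (L ω).Stays
      · rw [Set.indicator_of_mem (by exact h), cost, if_pos h]
        have hg := (gap_spec hω).1
        have : (1 : ℕ∞) ≤ hitTime (E ω).walk {((L ω).gap : ℤ)} := by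
          refine le_iInf₂ fun n hn => ?_
          cases n with
          | zero =>
            rw [walk_zero, Set.mem_singleton_iff] at hn
            omega
          | succ n => exact_mod_cast Nat.succ_le_succ (Nat.zero_le n)
        have h2 := ENat.toENNReal_le.2 this
        simpa using h2
      · rw [Set.indicator_of_notMem (by exact h)]
        exact zero_le
    exact hpos (le_antisymm (h0 ▸ hle) zero_le)
  have hDL0 : DL ≠ 0 := hcost_ge L
  have hDR0 : DR ≠ 0 := hcost_ge R
  have hmem : ∀ ω, (0 : ℤ) ∈ regenLevels (L ω).walk ↔ (L ω).Stays := fun ω => by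
    rw [mem_regenLevels_iff le_rfl ⟨0, walk_zero _⟩, shift_zero]
  have hpos_eq : ({ω | (0 : ℤ) ∈ regenLevels (L ω).walk}.indicator
      fun ω => (regenPos (L ω).walk : ℝ)) =ᵐ[P] fun ω => ((L ω).gapOn).toReal := by
    filter_upwards [hinf, hLhit] with ω h1 h2
    by_cases h : (L ω).Stays
    · rw [Set.indicator_of_mem (by exact (hmem ω).2 h), (regenTime_eq h1 h2).2, gapOn, if_pos h]
      simp
    · rw [Set.indicator_of_notMem (by exact (hmem ω).not.2 h), gapOn, if_neg h]
      simp
  have hgm : AEMeasurable (fun ω => (L ω).gapOn) P := (measurable_gapOn.comp hLm).aemeasurable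
  have hnum : ∫ ω, {ω | (0 : ℤ) ∈ regenLevels (L ω).walk}.indicator
      (fun ω => (regenPos (L ω).walk : ℝ)) ω ∂P = 1 := by
    rw [integral_congr_ae hpos_eq,
      integral_toReal hgm (ae_lt_top' hgm (by rw [hgap1]; exact ENNReal.one_ne_top)), hgap1]
    simp
  have hdenL : ∫⁻ ω, {ω | (0 : ℤ) ∈ regenLevels (L ω).walk}.indicator
      (fun ω => (regenTime (L ω).walk : ℝ≥0∞)) ω ∂P = DL := by
    refine lintegral_congr_ae ?_
    filter_upwards [hinf, hLhit] with ω h1 h2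
    by_cases h : (L ω).Stays
    · rw [Set.indicator_of_mem (by exact (hmem ω).2 h), (regenTime_eq h1 h2).1, cost, if_pos h]
    · rw [Set.indicator_of_notMem (by exact (hmem ω).not.2 h), cost, if_neg h]
  have hdenR : ∫⁻ ω, {ω | (0 : ℤ) ∈ regenLevels (L ω).walk}.indicator
      (fun ω => (hitTime (R ω).walk {regenPos (L ω).walk} : ℝ≥0∞)) ω ∂P = DR := by
    refine lintegral_congr_ae ?_
    filter_upwards [hinf, hLhit] with ω h1 h2
    by_cases h : (L ω).Stays
    · rw [Set.indicator_of_mem (by exact (hmem ω).2 h), (regenTime_eq h1 h2).2, cost, if_pos h]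
    · rw [Set.indicator_of_notMem (by exact (hmem ω).not.2 h), cost, if_neg h]
  refine ⟨_, inferInstance, P, inferInstance, L, R, hcoup, ?_, ?_, 1, DL, DR, (DL⁻¹).toReal,
    (DR⁻¹).toReal, ?_, hnum.symm, hdenL.symm, hdenR.symm, hDL0, hDR0, ?_, ?_,
    coe_toReal_inv_eq hDL0, coe_toReal_inv_eq hDR0⟩
  · filter_upwards [hLhit, hRhit, hstays] with ω h1 h2 h3 x hx
    obtain ⟨y, rfl⟩ := Int.eq_ofNat_of_zero_le hx.1
    exact (mem_regenLevels_iff hx.1 (h2 y)).2 (h3 y ((mem_regenLevels_iff hx.1 (h1 y)).1 hx))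
  · filter_upwards [hinf, hLhit, hRhit] with ω h1 h2 h3
    rw [(regenTime_eq h1 h2).1, (regenTime_eq h1 h2).2]
    exact ⟨hitTime_ne_top (h2 _), hitTime_ne_top (h3 _)⟩
  · refine (integrable_congr hpos_eq).2 (integrable_toReal_of_lintegral_ne_top hgm ?_)
    rw [hgap1]
    exact ENNReal.one_ne_top
  · refine isSpeed_of_ae hcoup.walk_left ?_
    filter_upwards [hdens, hcostL, hLhit] with ω h1 h2 h3
    exact tendsto_walk_div hpos (measure_ne_top _ _) hDL0 h1 h2 h3 fun _ => id
  · refine isSpeed_of_ae hcoup.walk_right ?_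
    filter_upwards [hdens, hcostR, hRhit, hstays] with ω h1 h2 h3 h4
    exact tendsto_walk_div hpos (measure_ne_top _ _) hDR0 h1 h2 h3 h4
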